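/- Let $k$ be a field of characteristic different from $2$, let $m,n\ge 0$ be integers, let $\lambda$ be a partition, and put $d=|\lambda|$. Let $M=k^{m|n}$ be the vector superspace with even basis $X_1,\dots,X_m$ and odd basis $Y_1,\dots,Y_n$, let $\Pi M$ be its parity change, and let $\mathfrak S_d$ act on the right of $M^{\otimes d}$ (and likewise of $(\Pi M)^{\otimes d}$) so that the transposition $(i\ i{+}1)$ exchanges the homogeneous factors $v_i,v_{i+1}$ with the sign $(-1)^{|v_i||v_{i+1}|}$. Write $S^r M=(M^{\otimes r})_{\mathfrak S_r}$ for the coinvariants (the $r$-th super symmetric power) and $\Gamma^r(\Pi M)=((\Pi M)^{\otimes r})^{\mathfrak S_r}$ for the invariants (the $r$-th super divided power). Let $\lambda'$ be the conjugate partition. The Schur supermodule $\widehat S_\lambda(k^{m|n})$ is the image of the composite $$\Gamma^{\lambda'_1}(\Pi M)\otimes\Gamma^{\lambda'_2}(\Pi M)\otimes\cdots\hookrightarrow(\Pi M)^{\otimes d}\cong M^{\otimes d}\xrightarrow{\ \sigma_\lambda\ }M^{\otimes d}\twoheadrightarrow S^{\lambda_1}M\otimes S^{\lambda_2}M\otimes\cdots,$$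 where the isomorphism is $1^{\otimes d}$ for the odd identity map $1:\Pi M\to M$ (with the rule of signs), and $\sigma_\lambda\in\mathfrak S_d$ sends the position of each cell of the diagram of $\lambda$ in the reading along rows to its position in the reading down columns. It is a submodule of $S^{\lambda_1}M\otimes S^{\lambda_2}M\otimes\cdots$ over the Schur superalgebra $S(m|n,d)=\mathrm{End}_{k\mathfrak S_d}(M^{\otimes d})$. For $\mu\in\mathbb Z_{\ge0}^{m+n}$ with $|\mu|=d$ let $E^{(\mu)}\in S(m|n,d)$ be the weight idempotent, that is, the projection of $M^{\otimes d}$ onto the span of the tensors of basis vectors in which the $i$-th basis vector (in the order $X_1,\dots,X_m,Y_1,\dots,Y_n$) occurs exactly $\mu_i$ times for every $i$, along the other such tensors. The formal character of a finite-dimensional $S(m|n,d)$-supermodule $V$ is $$\mathrm{ch}(V)=\sum_{|\mu|=d}\dim_k\bigl(E^{(\mu)}V\bigr)\,x_1^{\mu_1}\cdots x_m^{\mu_m}y_1^{\mu_{m+1}}\cdots y_n^{\mu_{m+n}}\in\mathbb Z[x_1,\dots,x_m;y_1,\dots,y_n].$$ Then $$\mathrm{ch}\bigl(\widehat S_\lambda(k^{m|n})\bigr)=hs_\lambda(x_1,\dots,x_m;y_1,\dots,y_n):=\sum_{\mu\subset\lambda}s_\mu(x_1,\dots,x_m)\,s_{\lambda'/\mu'}(y_1,\dots,y_n),$$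 the hook Schur function, where $\mu$ runs over the partitions contained in $\lambda$ and $s_{\alpha/\beta}$ (with $s_\alpha=s_{\alpha/\varnothing}$) is the skew Schur polynomial, the generating function of the semistandard tableaux of shape $\alpha/\beta$. -/

import Mathlib

open scoped TensorProduct

noncomputable section

namespace SchurSuper

/-! ### Superspaces with a homogeneous basis, and their tensor powers

A superspace with a homogeneous basis indexed by `ι` is the vector space `ι → k` together with a
parity function `p : ι → ZMod 2`.  Its parity change `Π` is the same vector space with parity
function `fun a => p a + 1`. -/

/-- The parity of the standard basis `X₁, …, X_m, Y₁, …, Y_n` of `k^{m|n}`. -/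
def parity (m n : ℕ) : Fin m ⊕ Fin n → ZMod 2 := Sum.elim (fun _ => 0) (fun _ => 1)

/-- The tensor power `M^{⊗ d}` of `M = k^ι`. -/
def TensorPow (k : Type*) [Field k] (ι : Type*) (d : ℕ) : Type _ :=
  ⨂[k] (_ : Fin d), (ι → k)

instance (k : Type*) [Field k] (ι : Type*) (d : ℕ) : AddCommGroup (TensorPow k ι d) :=
  inferInstanceAs (AddCommGroup (⨂[k] (_ : Fin d), (ι → k)))

instance (k : Type*) [Field k] (ι : Type*) (d : ℕ) : Module k (TensorPow k ι d) :=
  inferInstanceAs (Module k (⨂[k] (_ : Fin d), (ι → k)))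

section

variable {k : Type*} [Field k] {ι : Type*} [Fintype ι] {d : ℕ}

variable (k ι d) in
/-- The basis `Z^w = Z_{w 1} ⊗ ⋯ ⊗ Z_{w d}` of `M^{⊗ d}`, indexed by the words `w`. -/
def wordBasis : Module.Basis (Fin d → ι) k (TensorPow k ι d) :=
  Basis.piTensorProduct fun _ => Pi.basisFun k ι

/-- The pairs of positions `s < t` that are interchanged when a word `w` is replaced by `w ∘ σ`. -/
def inversions (σ : Equiv.Perm (Fin d)) : Finset (Fin d × Fin d) :=
  {st | st.1 < st.2 ∧ σ.symm st.2 < σ.symm st.1}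

/-- The sign in `Z^w . σ = ± Z^{w ∘ σ}`: a factor `-1` for each pair of odd letters that are
interchanged. -/
def superSign (p : ι → ZMod 2) (w : Fin d → ι) (σ : Equiv.Perm (Fin d)) : ℤˣ :=
  ∏ st ∈ inversions σ, (-1 : ℤˣ) ^ (p (w st.1) * p (w st.2))

variable (k) in
/-- The right action of a permutation `σ` on `M^{⊗ d}`, for `M = k^ι` with parity `p`:
the linear map `x ↦ x . σ` with `Z^w . σ = ± Z^{w ∘ σ}`. -/
def permAct (p : ι → ZMod 2) (σ : Equiv.Perm (Fin d)) : TensorPow k ι d →ₗ[k] TensorPow k ι d :=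
  (wordBasis k ι d).constr k fun w => superSign p w σ • wordBasis k ι d (w ∘ σ)

variable (k) in
/-- The map `1^{⊗ d} : (Π M)^{⊗ d} → M^{⊗ d}`, where `1 : Π M → M` is the odd identity map.
By the rule of signs, the `t`-th factor `1` moves past the elements `Π Z_{w s}` with `s < t`. -/
def parityShift (p : ι → ZMod 2) : TensorPow k ι d →ₗ[k] TensorPow k ι d :=
  (wordBasis k ι d).constr k fun w =>
    (∏ st : Fin d × Fin d with st.1 < st.2, (-1 : ℤˣ) ^ (p (w st.1) + 1)) • wordBasis k ι d w

/-- The Young subgroup of permutations of the positions that preserve each block; the block of a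
position `r` is labelled by `b r`. -/
def youngSubgroup (b : Fin d → ℕ) : Subgroup (Equiv.Perm (Fin d)) where
  carrier := {σ | ∀ r, b (σ r) = b r}
  mul_mem' := by
    intro σ τ hσ hτ r
    rw [Equiv.Perm.mul_apply, hσ, hτ]
  one_mem' := fun _ => rfl
  inv_mem' := by
    intro σ hσ r
    have h := hσ (σ.symm r)
    rw [Equiv.apply_symm_apply] at h
    exact h.symm

variable (k) in
/-- `Γ^{α₁} M ⊗ ⋯ ⊗ Γ^{α_q} M`, as the subspace of `M^{⊗ d}` of invariants under the Young subgroup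
`𝔖_{α₁} × ⋯ × 𝔖_{α_q}`, where `b` is the division of `{1, …, d}` into successive blocks of lengths
`α₁, …, α_q`. -/
def dividedPow (p : ι → ZMod 2) (b : Fin d → ℕ) : Submodule k (TensorPow k ι d) :=
  ⨅ σ ∈ youngSubgroup b, LinearMap.eqLocus (permAct k p σ) LinearMap.id

theorem permAct_wordBasis (p : ι → ZMod 2) (σ : Equiv.Perm (Fin d)) (w : Fin d → ι) :
    permAct k p σ (wordBasis k ι d w) = superSign p w σ • wordBasis k ι d (w ∘ σ) :=
  Module.Basis.constr_basis ..

theorem prod_pairs_comp (σ : Equiv.Perm (Fin d)) (f : Fin d → Fin d → ℤˣ) :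
    ∏ st : Fin d × Fin d with st.1 < st.2, f (σ st.1) (σ st.2) =
      ∏ st : Fin d × Fin d with st.1 < st.2,
        if σ.symm st.2 < σ.symm st.1 then f st.2 st.1 else f st.1 st.2 := by
  refine Finset.prod_bij'
    (fun st _ => if σ st.2 < σ st.1 then (σ st.2, σ st.1) else (σ st.1, σ st.2))
    (fun st _ => if σ.symm st.2 < σ.symm st.1 then (σ.symm st.2, σ.symm st.1) else (σ.symm st.1, σ.symm st.2))
    ?_ ?_ ?_ ?_ ?_
  · rintro ⟨s, t⟩ h
    have hne : σ s ≠ σ t := σ.injective.ne (by simp at h; exact h.ne)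
    by_cases h' : σ t < σ s
    · simp [h']
    · simpa [h'] using lt_of_le_of_ne (not_lt.1 h') hne
  · rintro ⟨s, t⟩ h
    have hne : σ.symm s ≠ σ.symm t := σ.symm.injective.ne (by simp at h; exact h.ne)
    by_cases h' : σ.symm t < σ.symm s
    · simp [h']
    · simpa [h'] using lt_of_le_of_ne (not_lt.1 h') hne
  · rintro ⟨s, t⟩ h
    replace h : s < t := by simpa using h
    by_cases h' : σ t < σ s
    · simp [h', h]
    · simp [h', h.not_gt]
  · rintro ⟨s, t⟩ h
    replace h : s < t := by simpa using h
    by_cases h' : σ.symm t < σ.symm s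
    · simp [h', h]
    · simp [h', h.not_gt]
  · rintro ⟨s, t⟩ h
    replace h : s < t := by simpa using h
    by_cases h' : σ t < σ s
    · simp [h', h]
    · simp [h', h.not_gt]

theorem prod_inversions (σ : Equiv.Perm (Fin d)) (f : Fin d × Fin d → ℤˣ) :
    ∏ st ∈ inversions σ, f st =
      ∏ st : Fin d × Fin d with st.1 < st.2, if σ.symm st.2 < σ.symm st.1 then f st else 1 := by
  rw [inversions, ← Finset.filter_filter, Finset.prod_filter]

theorem symm_mul' (σ τ : Equiv.Perm (Fin d)) (r : Fin d) : (σ * τ).symm r = τ.symm (σ.symm r) :=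
  rfl

/-- The maps `permAct` form a right action. -/
theorem permAct_mul (p : ι → ZMod 2) (σ τ : Equiv.Perm (Fin d)) (x : TensorPow k ι d) :
    permAct k p (σ * τ) x = permAct k p τ (permAct k p σ x) := by
  suffices h : permAct k p (σ * τ) = permAct k p τ ∘ₗ permAct k p σ from
    LinearMap.congr_fun h x
  refine (wordBasis k ι d).ext fun w => ?_
  rw [LinearMap.comp_apply, permAct_wordBasis, permAct_wordBasis, Units.smul_def, Units.smul_def,
    map_zsmul, permAct_wordBasis, Units.smul_def, smul_smul, ← Units.val_mul]
  have h : superSign p w (σ * τ) = superSign p w σ * superSign p (w ∘ σ) τ := by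
    have h2 := prod_pairs_comp σ fun s t =>
      if τ.symm (σ.symm t) < τ.symm (σ.symm s) then (-1 : ℤˣ) ^ (p (w s) * p (w t)) else 1
    simp only [Equiv.symm_apply_apply] at h2
    simp only [superSign, prod_inversions, Function.comp_apply, h2, ← Finset.prod_mul_distrib,
      symm_mul']
    refine Finset.prod_congr rfl ?_
    rintro ⟨s, t⟩ h
    have hne : τ.symm (σ.symm s) ≠ τ.symm (σ.symm t) := by simp at h; simpa using h.ne
    have hc : p (w t) * p (w s) = p (w s) * p (w t) := mul_comm _ _
    dsimp only
    rcases lt_or_gt_of_ne hne with h3 | h3 <;>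
      by_cases h1 : σ.symm t < σ.symm s <;>
      simp [h1, h3, h3.not_gt, hc, Int.units_mul_self]
  rw [h]
  rfl

theorem parityShift_wordBasis (p : ι → ZMod 2) (w : Fin d → ι) :
    parityShift k p (wordBasis k ι d w) =
      (∏ st : Fin d × Fin d with st.1 < st.2, (-1 : ℤˣ) ^ (p (w st.1) + 1)) •
        wordBasis k ι d w :=
  Module.Basis.constr_basis ..

theorem parityShift_parityShift (p : ι → ZMod 2) (x : TensorPow k ι d) :
    parityShift k p (parityShift k p x) = x := by
  suffices h : parityShift k p ∘ₗ parityShift k p = LinearMap.id (M := TensorPow k ι d) from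
    LinearMap.congr_fun h x
  refine (wordBasis k ι d).ext fun w => ?_
  rw [LinearMap.comp_apply, parityShift_wordBasis, Units.smul_def, map_zsmul,
    parityShift_wordBasis, Units.smul_def, smul_smul, ← Units.val_mul, Int.units_mul_self]
  simp

/-- `1^{⊗ d}` intertwines the actions on `(Π M)^{⊗ d}` and `M^{⊗ d}` up to the sign of the
permutation. -/
theorem parityShift_permAct (p : ι → ZMod 2) (σ : Equiv.Perm (Fin d)) (x : TensorPow k ι d) :
    parityShift k p (permAct k (fun a => p a + 1) σ x) =
      (∏ _st ∈ inversions σ, (-1 : ℤˣ)) • permAct k p σ (parityShift k p x) := by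
  suffices h : parityShift k p ∘ₗ permAct k (fun a => p a + 1) σ =
      ((((∏ _st ∈ inversions σ, (-1 : ℤˣ) : ℤˣ) : ℤ) : k)) •
        (permAct k p σ ∘ₗ parityShift k p) by
    have h' := LinearMap.congr_fun h x
    rwa [LinearMap.smul_apply, Int.cast_smul_eq_zsmul, ← Units.smul_def] at h'
  refine (wordBasis k ι d).ext fun w => ?_
  rw [LinearMap.smul_apply, Int.cast_smul_eq_zsmul, LinearMap.comp_apply, LinearMap.comp_apply,
    permAct_wordBasis, parityShift_wordBasis, Units.smul_def, Units.smul_def, map_zsmul, map_zsmul,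
    permAct_wordBasis, parityShift_wordBasis, Units.smul_def, Units.smul_def, smul_smul,
    smul_smul, smul_smul, ← Units.val_mul, ← Units.val_mul, ← Units.val_mul]
  congr 2
  have h2 := prod_pairs_comp σ fun s _ => (-1 : ℤˣ) ^ (p (w s) + 1)
  simp only [superSign, prod_inversions, Function.comp_apply, h2, ← Finset.prod_mul_distrib]
  refine Finset.prod_congr rfl ?_
  rintro ⟨s, t⟩ -
  dsimp only
  generalize p (w s) = a
  generalize p (w t) = b
  by_cases h1 : σ.symm t < σ.symm s
  · simp only [if_pos h1]
    revert a b
    decide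
  · simp [if_neg h1]

end

/-! ### The Schur superalgebra and its supermodules -/

section

variable (k : Type*) [Field k] (m n d : ℕ)

/-- The Schur superalgebra `S(m|n,d) = Γ^d End(M) ≅ End_{k𝔖_d}(M^{⊗ d})`, for `M = k^{m|n}`. -/
def SchurSuperalgebra : Subalgebra k (Module.End k (TensorPow k (Fin m ⊕ Fin n) d)) :=
  Subalgebra.centralizer k (Set.range (permAct k (parity m n)))

/-- The weight of a word: the number of occurrences of each letter. -/
def wordWeight {ι : Type*} [Fintype ι] [DecidableEq ι] {d : ℕ} (w : Fin d → ι) : ι →₀ ℕ :=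
  ∑ r, Finsupp.single (w r) 1

/-- The elementary tensor `E_{w₁,w₁} ⊗ ⋯ ⊗ E_{w_d,w_d}` of matrix units, as an endomorphism of
`M^{⊗ d}`.  All factors are even, so that no sign occurs. -/
def diagonalUnit {ι : Type*} [Fintype ι] [DecidableEq ι] {d : ℕ} (w : Fin d → ι) :
    Module.End k (TensorPow k ι d) :=
  PiTensorProduct.map fun r => Matrix.toLin' (Matrix.single (w r) (w r) (1 : k))

theorem diagonalUnit_wordBasis {ι : Type*} [Fintype ι] [DecidableEq ι] {d : ℕ}
    (w v : Fin d → ι) :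
    diagonalUnit k w (wordBasis k ι d v) = if w = v then wordBasis k ι d v else 0 := by
  have key : PiTensorProduct.map (fun r => Matrix.toLin' (Matrix.single (w r) (w r) (1 : k)))
      (Basis.piTensorProduct (fun _ => Pi.basisFun k ι) v) =
      if w = v then Basis.piTensorProduct (fun _ => Pi.basisFun k ι) v else 0 := by
    rw [Basis.piTensorProduct_apply, PiTensorProduct.map_tprod]
    split_ifs with h
    · subst h
      congr 1
      ext r a
      simp [Matrix.single_apply, Pi.single_apply, eq_comm]
    · obtain ⟨r, hr⟩ := Function.ne_iff.1 h
      refine (PiTensorProduct.tprod k).map_coord_zero r ?_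
      ext a
      simp [hr]
  exact key

theorem sum_diagonalUnit_wordBasis {ι : Type*} [Fintype ι] [DecidableEq ι] {d : ℕ}
    (μ : ι →₀ ℕ) (v : Fin d → ι) :
    (∑ w : Fin d → ι with wordWeight w = μ, diagonalUnit k w) (wordBasis k ι d v) =
      if wordWeight v = μ then wordBasis k ι d v else 0 := by
  rw [LinearMap.sum_apply]
  simp only [diagonalUnit_wordBasis, Finset.sum_ite_eq', Finset.mem_filter, Finset.mem_univ,
    true_and]

/-- The weight idempotent `E^{(μ)} ∈ S(m|n,d)`: the sum of `E_{w₁,w₁} ⊗ ⋯ ⊗ E_{w_d,w_d}` over the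
`𝔖_d`-orbit of words of weight `μ`. -/
def weightIdempotent (μ : Fin m ⊕ Fin n →₀ ℕ) : SchurSuperalgebra k m n d :=
  ⟨∑ w : Fin d → Fin m ⊕ Fin n with wordWeight w = μ, diagonalUnit k w, by
    rw [SchurSuperalgebra, Subalgebra.mem_centralizer_iff]
    rintro _ ⟨σ, rfl⟩
    refine (wordBasis k _ d).ext fun v => ?_
    have hw : wordWeight (v ∘ σ) = wordWeight v :=
      Equiv.sum_comp σ fun r => Finsupp.single (v r) 1
    rw [Module.End.mul_apply, Module.End.mul_apply, sum_diagonalUnit_wordBasis, permAct_wordBasis,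
      Units.smul_def, map_zsmul, sum_diagonalUnit_wordBasis, hw]
    split_ifs
    · rw [permAct_wordBasis, Units.smul_def]
    · simp⟩

section

variable (V : Type*) [AddCommGroup V] [Module k V] [Module (SchurSuperalgebra k m n d) V]
  [IsScalarTower k (SchurSuperalgebra k m n d) V]

/-- The weight space `V_μ = E^{(μ)} V` of an `S(m|n,d)`-supermodule `V`. -/
def weightSpace (μ : Fin m ⊕ Fin n →₀ ℕ) : Submodule k V :=
  LinearMap.range (Algebra.lsmul k k V (weightIdempotent k m n d μ))

/-- The formal character `∑_μ dim(V_μ) z^μ` of a finite-dimensional `S(m|n,d)`-supermodule `V`, the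
sum being over all `μ ∈ ℕ^{m+n}` with `|μ| = d`.  The variables are `x_i = X (Sum.inl i)` and
`y_j = X (Sum.inr j)`. -/
def formalCharacter [Module.Finite k V] : MvPolynomial (Fin m ⊕ Fin n) ℤ :=
  ∑ μ ∈ Finset.finsuppAntidiag (Finset.univ : Finset (Fin m ⊕ Fin n)) d,
    MvPolynomial.monomial μ (Module.finrank k (weightSpace k m n d V μ) : ℤ)

end

/-- The action of `σ` on `M^{⊗ d}`, as an endomorphism of `S(m|n,d)`-modules. -/
def permActLinear (σ : Equiv.Perm (Fin d)) :
    TensorPow k (Fin m ⊕ Fin n) d →ₗ[SchurSuperalgebra k m n d] TensorPow k (Fin m ⊕ Fin n) d where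
  toFun := permAct k (parity m n) σ
  map_add' := map_add _
  map_smul' f x := by
    have h := (Subalgebra.mem_centralizer_iff k).1 f.2 _ ⟨σ, rfl⟩
    exact LinearMap.congr_fun h x

theorem permAct_smul (σ : Equiv.Perm (Fin d)) (f : SchurSuperalgebra k m n d)
    (x : TensorPow k (Fin m ⊕ Fin n) d) :
    permAct k (parity m n) σ (f • x) = f • permAct k (parity m n) σ x :=
  (permActLinear k m n d σ).map_smul f x

variable {d}

/-- The `S(m|n,d)`-submodule of `M^{⊗ d}` spanned by all `x . σ - x` with `σ` in the Young
subgroup of `b`. -/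
def symRelations (b : Fin d → ℕ) :
    Submodule (SchurSuperalgebra k m n d) (TensorPow k (Fin m ⊕ Fin n) d) :=
  ⨆ σ ∈ youngSubgroup b, LinearMap.range (permActLinear k m n d σ - LinearMap.id)

/-- `S^{α₁} M ⊗ ⋯ ⊗ S^{α_q} M`, as the quotient of `M^{⊗ d}` of coinvariants under the Young
subgroup `𝔖_{α₁} × ⋯ × 𝔖_{α_q}`, with `b` the division into blocks of lengths `α₁, …, α_q`. -/
def SymPow (b : Fin d → ℕ) : Type _ :=
  TensorPow k (Fin m ⊕ Fin n) d ⧸ symRelations k m n b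

instance (b : Fin d → ℕ) : AddCommGroup (SymPow k m n b) :=
  inferInstanceAs (AddCommGroup (_ ⧸ symRelations k m n b))

instance (b : Fin d → ℕ) : Module (SchurSuperalgebra k m n d) (SymPow k m n b) :=
  inferInstanceAs (Module (SchurSuperalgebra k m n d) (_ ⧸ symRelations k m n b))

instance (b : Fin d → ℕ) : Module k (SymPow k m n b) :=
  inferInstanceAs (Module k (_ ⧸ symRelations k m n b))

instance (b : Fin d → ℕ) : IsScalarTower k (SchurSuperalgebra k m n d) (SymPow k m n b) :=
  inferInstanceAs (IsScalarTower k (SchurSuperalgebra k m n d) (_ ⧸ symRelations k m n b))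

/-- The multiplication map `m : M^{⊗ d} → S^{α₁} M ⊗ ⋯ ⊗ S^{α_q} M`. -/
def symMk (b : Fin d → ℕ) :
    TensorPow k (Fin m ⊕ Fin n) d →ₗ[SchurSuperalgebra k m n d] SymPow k m n b :=
  (symRelations k m n b).mkQ

end

/-! ### Partitions and Schur supermodules -/

/-- The enumeration of the cells of a Young diagram in the order in which `e` is
lexicographically increasing. -/
def readingOrder (lam : YoungDiagram) (e : ℕ × ℕ ≃ ℕ ×ₗ ℕ) : Fin lam.card ≃ lam.cells :=
  ((lam.cells.map e.toEmbedding).orderIsoOfFin (Finset.card_map _)).toEquiv.trans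
    (e.subtypeEquiv fun _ => (Finset.mem_map' e.toEmbedding).symm).symm

/-- Reading along rows, from top to bottom. -/
def rowReading (lam : YoungDiagram) : Fin lam.card ≃ lam.cells :=
  readingOrder lam toLex

/-- Reading down columns, from left to right. -/
def colReading (lam : YoungDiagram) : Fin lam.card ≃ lam.cells :=
  readingOrder lam ((Equiv.prodComm ℕ ℕ).trans toLex)

/-- The division of `{1, …, d}` into blocks of lengths `λ₁, λ₂, …`. -/
def rowBlock (lam : YoungDiagram) (r : Fin lam.card) : ℕ := (rowReading lam r).1.1

/-- The division of `{1, …, d}` into blocks of lengths `λ'₁, λ'₂, …`, the column lengths of `λ`. -/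
def colBlock (lam : YoungDiagram) (r : Fin lam.card) : ℕ := (colReading lam r).1.2

/-- The permutation `σ_λ` that sends the position of a cell in the row reading to its position in
the column reading. -/
def sigma (lam : YoungDiagram) : Equiv.Perm (Fin lam.card) :=
  (rowReading lam).trans (colReading lam).symm

section

variable (k : Type*) [Field k] (m n : ℕ) (lam : YoungDiagram)

/-- The map `θ̂_λ` from `Γ_Π^{λ'} M = Γ^{λ'₁}(Π M) ⊗ Γ^{λ'₂}(Π M) ⊗ ⋯` to
`S^λ M = S^{λ₁} M ⊗ S^{λ₂} M ⊗ ⋯`: the inclusion into `(Π M)^{⊗ d}`, the odd identification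
`1^{⊗ d}` of `(Π M)^{⊗ d}` with `M^{⊗ d}`, the action of `σ_λ`, and multiplication. -/
def theta :
    dividedPow k (fun a => parity m n a + 1) (colBlock lam) →ₗ[k] SymPow k m n (rowBlock lam) :=
  (symMk k m n (rowBlock lam)).restrictScalars k ∘ₗ permAct k (parity m n) (sigma lam) ∘ₗ
    parityShift k (parity m n) ∘ₗ
      (dividedPow k (fun a => parity m n a + 1) (colBlock lam)).subtype

theorem theta_apply (x : dividedPow k (fun a => parity m n a + 1) (colBlock lam)) :
    theta k m n lam x = symMk k m n (rowBlock lam)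
      (permActLinear k m n lam.card (sigma lam) (parityShift k (parity m n) x.1)) :=
  rfl

/-- The Schur supermodule `Ŝ_λ(k^{m|n})`: the image of `θ̂_λ`, an `S(m|n,d)`-submodule of `S^λ M`,
where `d = |λ|`. -/
def SchurSupermodule :
    Submodule (SchurSuperalgebra k m n lam.card) (SymPow k m n (rowBlock lam)) where
  carrier := Set.range (theta k m n lam)
  add_mem' := by
    rintro _ _ ⟨x, rfl⟩ ⟨y, rfl⟩
    exact ⟨x + y, map_add _ _ _⟩
  zero_mem' := ⟨0, map_zero _⟩
  smul_mem' := by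
    rintro f _ ⟨⟨x, hx⟩, rfl⟩
    refine ⟨⟨parityShift k (parity m n) (f • parityShift k (parity m n) x), ?_⟩, ?_⟩
    · simp only [dividedPow, Submodule.mem_iInf, LinearMap.mem_eqLocus, LinearMap.id_apply]
        at hx ⊢
      intro σ hσ
      apply (Function.LeftInverse.injective (parityShift_parityShift (k := k) (parity m n)))
      rw [parityShift_permAct, parityShift_parityShift]
      rw [permAct_smul, Units.smul_def, ← smul_comm, ← Units.smul_def, ← parityShift_permAct,
        hx σ hσ]
    · rw [theta_apply, theta_apply, parityShift_parityShift, map_smul, map_smul]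

instance : Module.Finite k (TensorPow k (Fin m ⊕ Fin n) lam.card) :=
  Module.Finite.of_basis (wordBasis k (Fin m ⊕ Fin n) lam.card)

instance : Module.Finite k (SymPow k m n (rowBlock lam)) :=
  Module.Finite.of_surjective ((symMk k m n (rowBlock lam)).restrictScalars k)
    (Submodule.mkQ_surjective (symRelations k m n (rowBlock lam)))

instance : Module.Finite k (SchurSupermodule k m n lam) :=
  Module.Finite.of_injective
    ((SchurSupermodule k m n lam).subtype.restrictScalars k) Subtype.val_injective

end

/-! ### Hook Schur functions -/

/-- The semistandard tableaux of skew shape `lam / mu` with entries in `{1, …, n}`: the entries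
weakly increase along the rows and strictly increase down the columns. -/
def skewTableaux (n : ℕ) (lam mu : YoungDiagram) :
    Set ((lam.cells \ mu.cells : Finset (ℕ × ℕ)) → Fin n) :=
  {T | (∀ c c', c.1.1 = c'.1.1 → c.1.2 < c'.1.2 → T c ≤ T c') ∧
    (∀ c c', c.1.2 = c'.1.2 → c.1.1 < c'.1.1 → T c < T c')}

open Classical in
/-- The skew Schur polynomial `s_{lam/mu}(x₁, …, x_n)`, for `mu ≤ lam`. -/
def skewSchur (n : ℕ) (lam mu : YoungDiagram) : MvPolynomial (Fin n) ℤ :=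
  ∑ T ∈ (skewTableaux n lam mu).toFinset, ∏ c, MvPolynomial.X (T c)

/-- The Schur polynomial `s_mu(x₁, …, x_n)`. -/
def schur (n : ℕ) (mu : YoungDiagram) : MvPolynomial (Fin n) ℤ := skewSchur n mu ⊥

theorem finite_subdiagrams (lam : YoungDiagram) : {mu : YoungDiagram | mu ≤ lam}.Finite := by
  refine Set.Finite.of_finite_image (f := YoungDiagram.cells)
    ((lam.cells.powerset.finite_toSet).subset ?_) ?_
  · rintro _ ⟨mu, hmu, rfl⟩
    exact Finset.mem_coe.2 (Finset.mem_powerset.2 hmu)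
  · intro mu _ nu _ h
    exact YoungDiagram.ext h

/-- The hook Schur function
`hs_λ(x₁, …, x_m; y₁, …, y_n) = ∑_{μ ⊆ λ} s_μ(x₁, …, x_m) s_{λ'/μ'}(y₁, …, y_n)`. -/
def hookSchur (m n : ℕ) (lam : YoungDiagram) : MvPolynomial (Fin m ⊕ Fin n) ℤ :=
  ∑ mu ∈ (finite_subdiagrams lam).toFinset,
    MvPolynomial.rename Sum.inl (schur m mu) *
      MvPolynomial.rename Sum.inr (skewSchur n lam.transpose mu.transpose)

end SchurSuper

end

/-!
Expand tensors in the basis of words. Once the odd identity `Π M → M` and `σ_λ` are absorbed, the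
Schur supermodule is the image in `S^λ M` of the tensors on which the column group acts by its sign
character. As `char k ≠ 2`, these tensors are spanned by signed sums over column orbits of words,
and a tensor vanishes in `S^λ M` if and only if it pairs to zero with all signed sums over row
orbits. The images of the column sums of the semistandard words form a basis.

* Independence: the pairing of row sums with column sums, restricted to semistandard words, is
  unitriangular with respect to the statistic `∑ row(r) * rank(w r)`.
* Spanning: over `ℚ` the column sum of any word is straightened by Garnir relations, each of which
  moves a violation of the row condition towards larger `∑ col(r) * rank(w r)`. The coefficients
  solve a linear system over `ℤ` of determinant one, so they are integers and the relation holds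
  over `k`.

Basis vectors are weight vectors, so the character is the generating function of the semistandard
words. The even letters of such a word fill a partition `μ ⊆ λ` with a semistandard tableau, and the
odd letters, transposed, form a semistandard tableau of shape `λ' / μ'`.
-/

noncomputable section

namespace SchurSuper

/-! ### Signs -/

section Signs

/-- The cocycle condition on the signs `χ w σ`, under which `g ↦ (w ↦ χ w σ * g (w ∘ σ))` is an
action of the permutations on the functions of words. -/
def IsSignCocycle {α ι : Type*} (χ : (α → ι) → Equiv.Perm α → ℤˣ) : Prop :=
  ∀ w σ τ, χ w (σ * τ) = χ w σ * χ (w ∘ σ) τ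

variable {ι : Type*} {d : ℕ}

theorem units_smul_wordBasis_injective [Fintype ι] (w : Fin d → ι) :
    Function.Injective fun a : ℤˣ => a • wordBasis ℚ ι d w := by
  intro a b hab
  simp only [Units.smul_def, ← Int.cast_smul_eq_zsmul ℚ] at hab
  exact Units.ext (Int.cast_injective (smul_left_injective ℚ ((wordBasis ℚ ι d).ne_zero w) hab))

theorem isSignCocycle_superSign (p : ι → ZMod 2) :
    IsSignCocycle (superSign p : (Fin d → ι) → Equiv.Perm (Fin d) → ℤˣ) := by
  intro w σ τ
  -- Only the letters of `w` matter, and the words in finitely many letters are a basis of tensors.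
  have : Fintype (Set.range w) := Fintype.ofFinite _
  let p' : Set.range w → ZMod 2 := p ∘ Subtype.val
  let v := Set.rangeFactorization w
  change superSign p' v (σ * τ) = superSign p' v σ * superSign p' (v ∘ σ) τ
  refine units_smul_wordBasis_injective (v ∘ (σ * τ : Equiv.Perm (Fin d))) ?_
  have hact := permAct_mul (k := ℚ) p' σ τ (wordBasis ℚ _ d v)
  simp only [permAct_wordBasis, Units.smul_def, map_zsmul, smul_smul] at hact ⊢
  exact hact

theorem prod_inversions_neg_one (σ : Equiv.Perm (Fin d)) :
    ∏ _st ∈ inversions σ, (-1 : ℤˣ) = Equiv.Perm.sign σ := by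
  rw [← Equiv.Perm.sign_symm, Equiv.Perm.sign_eq_prod_prod_Iio, prod_inversions,
    Finset.prod_filter, ← Finset.univ_product_univ, Finset.prod_product_right]
  refine Finset.prod_congr rfl fun t _ => ?_
  rw [← Finset.prod_filter]
  refine Finset.prod_congr (by ext; simp) fun s hs => ?_
  have hne : σ.symm s ≠ σ.symm t := σ.symm.injective.ne (Finset.mem_Iio.1 hs).ne
  rcases lt_or_gt_of_ne hne with h | h <;> simp [h, h.not_gt]

theorem superSign_eq_one_of_fixes_odd {p : ι → ZMod 2} {w : Fin d → ι} {σ : Equiv.Perm (Fin d)}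
    (h : ∀ r, p (w r) ≠ 0 → σ r = r) : superSign p w σ = 1 := by
  refine Finset.prod_eq_one fun ⟨s, t⟩ hst => ?_
  obtain ⟨hlt, hinv⟩ : s < t ∧ σ.symm t < σ.symm s := by simpa [inversions] using hst
  by_cases hs : p (w s) = 0
  · simp [hs]
  by_cases ht : p (w t) = 0
  · simp [ht]
  rw [(Equiv.symm_apply_eq σ).2 (h _ hs).symm, (Equiv.symm_apply_eq σ).2 (h _ ht).symm] at hinv
  exact absurd hlt hinv.not_gt

/-- The sign of the action of `σ` on a word, twisted by the sign character; it governs the column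
condition in the definition of the Schur supermodule once `(Π M)^{⊗ d}` is replaced by
`M^{⊗ d}`. -/
def twistedSign (p : ι → ZMod 2) (w : Fin d → ι) (σ : Equiv.Perm (Fin d)) : ℤˣ :=
  Equiv.Perm.sign σ * superSign p w σ

theorem isSignCocycle_twistedSign (p : ι → ZMod 2) :
    IsSignCocycle (twistedSign p : (Fin d → ι) → Equiv.Perm (Fin d) → ℤˣ) := by
  intro w σ τ
  simp only [twistedSign, isSignCocycle_superSign p w, Equiv.Perm.sign_mul]
  exact mul_mul_mul_comm ..

theorem superSign_add_one (p : ι → ZMod 2) {w : Fin d → ι} {σ : Equiv.Perm (Fin d)}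
    (hw : w ∘ σ = w) : superSign (fun a => p a + 1) w σ = twistedSign p w σ := by
  have : Fintype (Set.range w) := Fintype.ofFinite _
  let p' : Set.range w → ZMod 2 := p ∘ Subtype.val
  let v := Set.rangeFactorization w
  have hv : v ∘ σ = v := funext fun r => Subtype.ext (congr_fun hw r)
  change superSign (fun a => p' a + 1) v σ = Equiv.Perm.sign σ * superSign p' v σ
  have hact := parityShift_permAct (k := ℚ) p' σ (wordBasis ℚ _ d v)
  simp only [permAct_wordBasis, parityShift_wordBasis, hv, Units.smul_def, map_zsmul, smul_smul,
    ← Units.val_mul, prod_inversions_neg_one] at hact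
  rw [← mul_assoc, mul_right_comm] at hact
  exact mul_right_cancel (units_smul_wordBasis_injective v hact)

theorem parity_eq_zero_of_add_one_ne_zero : ∀ {a : ZMod 2}, a + 1 ≠ 0 → a = 0 := by decide

theorem twistedSign_eq_one_of_fixes_even {p : ι → ZMod 2} {w : Fin d → ι}
    {σ : Equiv.Perm (Fin d)} (hw : w ∘ σ = w) (h : ∀ r, p (w r) = 0 → σ r = r) :
    twistedSign p w σ = 1 := by
  rw [← superSign_add_one p hw]
  exact superSign_eq_one_of_fixes_odd fun r hr => h r (parity_eq_zero_of_add_one_ne_zero hr)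

end Signs

/-! ### Equivariant functions of words -/

section Equivariant

variable {α ι : Type*} (k : Type*) (χ : (α → ι) → Equiv.Perm α → ℤˣ)
  (H : Subgroup (Equiv.Perm α))

/-- The words on whose stabilizer in `H` the signs `χ` are trivial: these are the words that can
occur in an `H`-equivariant function. -/
def Admissible (u : α → ι) : Prop := ∀ σ ∈ H, u ∘ σ = u → χ u σ = 1

open Classical in
/-- The coefficient of `v` in the signed sum over the `H`-orbit of `u`. It does not depend on the
choice of `σ` if `u` is admissible. -/
def orbitCoeff (u v : α → ι) : ℤ :=
  if h : ∃ σ ∈ H, u ∘ σ = v then (χ u h.choose : ℤ) else 0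

/-- The functions of words that `H` multiplies by the signs `χ`. -/
def equivariantFunctions [CommRing k] : Submodule k ((α → ι) → k) where
  carrier := {g | ∀ w, ∀ σ ∈ H, g (w ∘ σ) = (χ w σ : ℤ) * g w}
  zero_mem' := by simp
  add_mem' := by
    intro f g hf hg w σ hσ
    simp only [Pi.add_apply, hf w σ hσ, hg w σ hσ, mul_add]
  smul_mem' := by
    intro c g hg w σ hσ
    simp only [Pi.smul_apply, smul_eq_mul, hg w σ hσ, mul_left_comm]

variable {k χ H}

theorem comp_comp_inv (v : α → ι) (σ : Equiv.Perm α) :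
    (v ∘ σ) ∘ (σ⁻¹ : Equiv.Perm α) = v :=
  funext fun r => congr_arg v (σ.apply_symm_apply r)

theorem Admissible.eq_of_comp_eq (hχ : IsSignCocycle χ) {u : α → ι} (hu : Admissible χ H u)
    {σ τ : Equiv.Perm α} (hσ : σ ∈ H) (hτ : τ ∈ H) (h : u ∘ σ = u ∘ τ) : χ u σ = χ u τ := by
  have hstab : u ∘ (σ * τ⁻¹ : Equiv.Perm α) = u := by
    rw [Equiv.Perm.coe_mul, ← Function.comp_assoc, h, comp_comp_inv]
  have hmul := hχ u (σ * τ⁻¹) τ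
  rwa [inv_mul_cancel_right, hstab, hu _ (H.mul_mem hσ (H.inv_mem hτ)) hstab, one_mul] at hmul

theorem orbitCoeff_comp (hχ : IsSignCocycle χ) {u : α → ι} (hu : Admissible χ H u)
    {σ : Equiv.Perm α} (hσ : σ ∈ H) : orbitCoeff χ H u (u ∘ σ) = χ u σ := by
  have hex : ∃ τ ∈ H, u ∘ τ = u ∘ σ := ⟨σ, hσ, rfl⟩
  rw [orbitCoeff, dif_pos hex]
  obtain ⟨hmem, hcomp⟩ := hex.choose_spec
  rw [hu.eq_of_comp_eq hχ hmem hσ hcomp]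

theorem orbitCoeff_self (hχ : IsSignCocycle χ) {u : α → ι} (hu : Admissible χ H u) :
    orbitCoeff χ H u u = 1 := by
  have hone : χ u 1 = 1 := hu 1 H.one_mem rfl
  simpa [hone] using orbitCoeff_comp hχ hu H.one_mem

theorem exists_of_orbitCoeff_ne_zero {u v : α → ι} (h : orbitCoeff χ H u v ≠ 0) :
    ∃ σ ∈ H, u ∘ σ = v := by
  by_contra hne
  exact h (dif_neg hne)

theorem orbitCoeff_mem_equivariantFunctions [CommRing k] (hχ : IsSignCocycle χ) {u : α → ι}
    (hu : Admissible χ H u) :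
    (fun v => (orbitCoeff χ H u v : k)) ∈ equivariantFunctions k χ H := by
  intro w σ hσ
  by_cases hw : ∃ τ ∈ H, u ∘ τ = w
  · obtain ⟨τ, hτ, rfl⟩ := hw
    beta_reduce
    rw [Function.comp_assoc, ← Equiv.Perm.coe_mul, orbitCoeff_comp hχ hu (H.mul_mem hτ hσ),
      orbitCoeff_comp hχ hu hτ, hχ, Units.val_mul, Int.cast_mul, mul_comm]
  · have hwσ : ¬ ∃ τ ∈ H, u ∘ τ = w ∘ σ := by
      rintro ⟨τ, hτ, h⟩
      refine hw ⟨τ * σ⁻¹, H.mul_mem hτ (H.inv_mem hσ), ?_⟩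
      rw [Equiv.Perm.coe_mul, ← Function.comp_assoc, h, comp_comp_inv]
    simp [orbitCoeff, hw, hwσ]

theorem admissible_of_mem_equivariantFunctions [CommRing k] [NoZeroDivisors k]
    (h2 : (2 : k) ≠ 0) {g : (α → ι) → k} (hg : g ∈ equivariantFunctions k χ H) {u : α → ι}
    (hu : g u ≠ 0) : Admissible χ H u := by
  intro σ hσ hfix
  refine (Int.units_eq_one_or (χ u σ)).resolve_right fun hsign => ?_
  have heq := hg u σ hσ
  rw [hfix, hsign, Units.val_neg, Units.val_one, Int.cast_neg, Int.cast_one] at heq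
  exact mul_ne_zero h2 hu (by linear_combination heq)

theorem support_sub_smul_orbitCoeff_ssubset [CommRing k] (hχ : IsSignCocycle χ)
    {g : (α → ι) → k} (hg : g ∈ equivariantFunctions k χ H) {u : α → ι}
    (hu : g u ≠ 0) (hadm : Admissible χ H u) :
    Function.support (g - g u • fun v => (orbitCoeff χ H u v : k)) ⊂ Function.support g := by
  refine ⟨fun v hv hgv => hv ?_, fun h => h hu ?_⟩
  · have hcoeff : orbitCoeff χ H u v = 0 := by
      by_contra hne
      obtain ⟨σ, hσ, rfl⟩ := exists_of_orbitCoeff_ne_zero hne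
      rw [hg u σ hσ] at hgv
      rcases Int.units_eq_one_or (χ u σ) with hsign | hsign <;>
        exact hu (by simpa [hsign] using hgv)
    simp [hgv, hcoeff]
  · simp [orbitCoeff_self hχ hadm]

theorem equivariantFunctions_eq_span [Finite α] [Finite ι] [CommRing k] [NoZeroDivisors k]
    (h2 : (2 : k) ≠ 0) (hχ : IsSignCocycle χ) :
    equivariantFunctions k χ H =
      Submodule.span k ((fun u v => (orbitCoeff χ H u v : k)) '' {u | Admissible χ H u}) := by
  refine le_antisymm (fun g hg => ?_) (Submodule.span_le.2 ?_)
  · induction hsupp : (Function.support g) using WellFoundedLT.induction generalizing g with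
    | _ S ih =>
    by_cases hzero : g = 0
    · exact hzero ▸ Submodule.zero_mem _
    obtain ⟨u, hu⟩ := Function.ne_iff.1 hzero
    have hadm := admissible_of_mem_equivariantFunctions h2 hg hu
    have hrest := ih _ (hsupp ▸ support_sub_smul_orbitCoeff_ssubset hχ hg hu hadm) _
      (Submodule.sub_mem _ hg
        (Submodule.smul_mem _ _ (orbitCoeff_mem_equivariantFunctions hχ hadm))) rfl
    rw [← sub_add_cancel g]
    exact Submodule.add_mem _ hrest
      (Submodule.smul_mem _ _ (Submodule.subset_span ⟨u, hadm, rfl⟩))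
  · rintro _ ⟨u, hu, rfl⟩
    exact orbitCoeff_mem_equivariantFunctions hχ hu

end Equivariant

/-! ### Rearrangement within blocks -/

section Rearrangement

variable {d : ℕ} {b o f : Fin d → ℕ}

theorem swap_mem_youngSubgroup {r s : Fin d} (h : b r = b s) :
    Equiv.swap r s ∈ youngSubgroup b := by
  intro x
  rw [Equiv.swap_apply_def]
  split_ifs with hxr hxs
  · rw [hxr, h]
  · rw [hxs, h]
  · rfl

theorem sum_mul_comp_of_mem_youngSubgroup {τ : Equiv.Perm (Fin d)} (hτ : τ ∈ youngSubgroup b) :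
    ∑ r, b r * f (τ r) = ∑ r, b r * f r := by
  rw [← Equiv.sum_comp τ fun r => b r * f r]
  exact Finset.sum_congr rfl fun r _ => by rw [hτ r]

theorem sum_mul_swap {α R : Type*} [Fintype α] [DecidableEq α] [CommRing R] (f g : α → R)
    (r s : α) :
    ∑ x, f x * g (Equiv.swap r s x) = ∑ x, f x * g x + (f s - f r) * (g r - g s) := by
  rcases eq_or_ne r s with rfl | hrs
  · simp
  rw [← sub_eq_iff_eq_add', ← Finset.sum_sub_distrib, Fintype.sum_eq_add r s hrs]
  · rw [Equiv.swap_apply_left, Equiv.swap_apply_right]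
    ring
  · intro x hx
    rw [Equiv.swap_apply_of_ne_of_ne hx.1 hx.2, sub_self]

/-- Within each block of `b` the function `f` weakly increases in the order given by `o`. -/
def IsBlockSorted {α : Type*} (b o f : α → ℕ) : Prop :=
  ∀ r s, b r = b s → o r < o s → f r ≤ f s

theorem isBlockSorted_comp_of_maximal {τ : Equiv.Perm (Fin d)} (hτ : τ ∈ youngSubgroup b)
    (hmax : ∀ σ ∈ youngSubgroup b, ∑ r, o r * f (σ r) ≤ ∑ r, o r * f (τ r)) :
    IsBlockSorted b o (f ∘ τ) := by
  intro r s hb ho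
  have hle := hmax _ (Subgroup.mul_mem _ hτ (swap_mem_youngSubgroup hb))
  have hswap := sum_mul_swap (fun x => (o x : ℤ)) (fun x => (f (τ x) : ℤ)) r s
  simp only [Equiv.Perm.mul_apply] at hle
  zify at hle ho ⊢
  rw [hswap] at hle
  by_contra! hlt
  simp only [Function.comp_apply] at hlt
  nlinarith

theorem exists_maximal_sum_mul_comp (b o f : Fin d → ℕ) :
    ∃ τ ∈ youngSubgroup b, ∀ σ ∈ youngSubgroup b,
      ∑ r, o r * f (σ r) ≤ ∑ r, o r * f (τ r) :=
  Set.exists_max_image (youngSubgroup b : Set (Equiv.Perm (Fin d)))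
    (fun σ => ∑ r, o r * f (σ r)) (Set.toFinite _) ⟨1, Subgroup.one_mem _⟩

theorem exists_isBlockSorted_comp (b o f : Fin d → ℕ) :
    ∃ τ ∈ youngSubgroup b, IsBlockSorted b o (f ∘ τ) := by
  obtain ⟨τ, hτ, hmax⟩ := exists_maximal_sum_mul_comp b o f
  exact ⟨τ, hτ, isBlockSorted_comp_of_maximal hτ hmax⟩

theorem IsBlockSorted.toLex_le {α : Type*} {b o f : α → ℕ} (hf : IsBlockSorted b o f)
    (hinj : ∀ r s, b r = b s → o r = o s → r = s) {r s : α}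
    (h : toLex (b r, o r) ≤ toLex (b s, o s)) : toLex (b r, f r) ≤ toLex (b s, f s) := by
  rw [Prod.Lex.toLex_le_toLex] at h ⊢
  refine h.imp_right fun ⟨hb, ho⟩ => ⟨hb, ?_⟩
  rcases ho.eq_or_lt with heq | hlt
  · exact (congr_arg f (hinj r s hb heq)).le
  · exact hf r s hb hlt

theorem IsBlockSorted.comp_eq (hinj : ∀ r s, b r = b s → o r = o s → r = s)
    (hf : IsBlockSorted b o f) {τ : Equiv.Perm (Fin d)} (hτ : τ ∈ youngSubgroup b)
    (hfτ : IsBlockSorted b o (f ∘ τ)) : f ∘ τ = f := by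
  let sorting : Equiv.Perm (Fin d) := Tuple.sort fun r => toLex (b r, o r)
  have hmono : ∀ {g : Fin d → ℕ}, IsBlockSorted b o g →
      Monotone ((fun r => toLex (b r, g r)) ∘ sorting) := fun hg _ _ hxy =>
    hg.toLex_le hinj (Tuple.monotone_sort (fun r => toLex (b r, o r)) hxy)
  have hcomp : (fun r => toLex (b r, (f ∘ τ) r)) = (fun r => toLex (b r, f r)) ∘ τ :=
    funext fun r => by simp only [Function.comp_apply, hτ r]
  have hunique : (fun r => toLex (b r, f r)) ∘ (τ * sorting : Equiv.Perm (Fin d)) =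
      (fun r => toLex (b r, f r)) ∘ sorting :=
    Tuple.unique_monotone (by simpa only [hcomp] using! hmono hfτ) (hmono hf)
  funext r
  have hr := congr_fun hunique (sorting.symm r)
  simp only [Function.comp_apply, Equiv.Perm.mul_apply, Equiv.apply_symm_apply, hτ r] at hr
  exact congr_arg (fun x => (ofLex x).2) hr

theorem IsBlockSorted.sum_mul_comp_le (hinj : ∀ r s, b r = b s → o r = o s → r = s)
    (hf : IsBlockSorted b o f) {τ : Equiv.Perm (Fin d)} (hτ : τ ∈ youngSubgroup b) :
    ∑ r, o r * f (τ r) ≤ ∑ r, o r * f r := by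
  obtain ⟨σ, hσ, hmax⟩ := exists_maximal_sum_mul_comp b o f
  have hfσ := hf.comp_eq hinj hσ (isBlockSorted_comp_of_maximal hσ hmax)
  simpa only [← Function.comp_apply (f := f) (g := σ), hfσ] using hmax τ hτ

theorem IsBlockSorted.comp_eq_of_sum_mul_eq (hinj : ∀ r s, b r = b s → o r = o s → r = s)
    (hf : IsBlockSorted b o f) {τ : Equiv.Perm (Fin d)} (hτ : τ ∈ youngSubgroup b)
    (hsum : ∑ r, o r * f (τ r) = ∑ r, o r * f r) : f ∘ τ = f :=
  hf.comp_eq hinj hτ <| isBlockSorted_comp_of_maximal hτ fun _ hσ =>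
    hsum ▸ hf.sum_mul_comp_le hinj hσ

/-- The permutations that move only elements of `C`. -/
def permsOn {α : Type*} (C : Finset α) : Subgroup (Equiv.Perm α) :=
  fixingSubgroup (Equiv.Perm α) (C : Set α)ᶜ

theorem mem_permsOn {α : Type*} {C : Finset α} {σ : Equiv.Perm α} :
    σ ∈ permsOn C ↔ ∀ r ∉ C, σ r = r := by
  simp [permsOn, mem_fixingSubgroup_iff]

theorem swap_mem_permsOn {α : Type*} [DecidableEq α] {C : Finset α} {r s : α} (hr : r ∈ C)
    (hs : s ∈ C) : Equiv.swap r s ∈ permsOn C :=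
  mem_permsOn.2 fun _ hx => Equiv.swap_apply_of_ne_of_ne (fun h => hx (h ▸ hr))
    fun h => hx (h ▸ hs)

theorem mem_of_mem_permsOn {α : Type*} {C : Finset α} {σ : Equiv.Perm α} (hσ : σ ∈ permsOn C)
    {r : α} (hr : σ r ≠ r) : r ∈ C ∧ σ r ∈ C := by
  rw [mem_permsOn] at hσ
  exact ⟨by_contra fun h => hr (hσ r h), by_contra fun h => hr (σ.injective (hσ _ h))⟩

theorem exists_lt_apply_of_notMem_youngSubgroup {σ : Equiv.Perm (Fin d)}
    (hσ : σ ∉ youngSubgroup b) : ∃ r, b r < b (σ r) := by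
  by_contra! h
  exact hσ fun r => (Finset.sum_eq_sum_iff_of_le fun r _ => h r).1 (Equiv.sum_comp σ b) r
    (Finset.mem_univ r)

theorem exists_apply_lt_of_notMem_youngSubgroup {σ : Equiv.Perm (Fin d)}
    (hσ : σ ∉ youngSubgroup b) : ∃ r, b (σ r) < b r := by
  by_contra! h
  exact hσ fun r => ((Finset.sum_eq_sum_iff_of_le fun r _ => h r).1 (Equiv.sum_comp σ b).symm r
    (Finset.mem_univ r)).symm

theorem card_mul_swap_ne_lt {σ : Equiv.Perm (Fin d)} {r s : Fin d} (hr : b (σ r) ≠ b r)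
    (hrs : b (σ s) = b r) (hsr : b (σ r) = b s) :
    ({x | b ((σ * Equiv.swap r s) x) ≠ b x} : Finset (Fin d)).card <
      ({x | b (σ x) ≠ b x} : Finset (Fin d)).card := by
  refine Finset.card_lt_card (Finset.ssubset_iff_of_subset ?_ |>.2 ⟨r, ?_, ?_⟩)
  · intro x
    rw [Finset.mem_filter_univ, Finset.mem_filter_univ, Equiv.Perm.mul_apply,
      Equiv.swap_apply_def]
    split_ifs with hxr hxs
    · simp [hxr, hrs]
    · simp [hxs, hsr]
    · exact id
  · exact (Finset.mem_filter_univ r).2 hr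
  · rw [Finset.mem_filter_univ, Equiv.Perm.mul_apply, Equiv.swap_apply_left]
    exact fun h => h hrs

theorem exists_comp_eq_of_antivaryOn {C : Finset (Fin d)} {j j' : ℕ} (hj : j < j')
    (hC : ∀ r ∈ C, b r = j ∨ b r = j') (hf : AntivaryOn f b C) {σ : Equiv.Perm (Fin d)}
    (hσ : σ ∈ permsOn C) (hfσ : AntivaryOn (f ∘ σ) b C) :
    ∃ τ ∈ youngSubgroup b, τ ∈ permsOn C ∧ f ∘ σ = f ∘ τ := by
  induction hN : ({x | b (σ x) ≠ b x} : Finset (Fin d)).card using Nat.strong_induction_on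
    generalizing σ with
  | _ N ih =>
  by_cases hmem : σ ∈ youngSubgroup b
  · exact ⟨σ, hmem, hσ, rfl⟩
  obtain ⟨r, hr⟩ := exists_lt_apply_of_notMem_youngSubgroup hmem
  obtain ⟨s, hs⟩ := exists_apply_lt_of_notMem_youngSubgroup hmem
  obtain ⟨hrC, hσrC⟩ := mem_of_mem_permsOn hσ (fun h => hr.ne' (congr_arg b h))
  obtain ⟨hsC, hσsC⟩ := mem_of_mem_permsOn hσ (fun h => hs.ne (congr_arg b h))
  obtain ⟨hrs, hsr, hlt⟩ : b (σ s) = b r ∧ b (σ r) = b s ∧ b r < b s := by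
    have := hC _ hrC
    have := hC _ hσrC
    have := hC _ hsC
    have := hC _ hσsC
    omega
  have hval : f (σ r) = f (σ s) :=
    (hf hσsC hσrC (by omega)).antisymm (hfσ hrC hsC hlt)
  have hcomp : f ∘ (σ * Equiv.swap r s : Equiv.Perm (Fin d)) = f ∘ σ := by
    funext x
    simp only [Function.comp_apply, Equiv.Perm.mul_apply, Equiv.swap_apply_def]
    split_ifs with hxr hxs
    · rw [hxr, hval]
    · rw [hxs, hval]
    · rfl
  obtain ⟨τ, hτ, hτC, heq⟩ := ih _ (hN ▸ card_mul_swap_ne_lt hr.ne' hrs hsr)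
    (Subgroup.mul_mem _ hσ (swap_mem_permsOn hrC hsC)) (hcomp ▸ hfσ) rfl
  exact ⟨τ, hτ, hτC, hcomp ▸ heq⟩

theorem sum_mul_lt_or_exists_comp_eq {C : Finset (Fin d)} {j j' : ℕ} (hj : j < j')
    (hC : ∀ r ∈ C, b r = j ∨ b r = j') (hf : AntivaryOn f b C) {σ : Equiv.Perm (Fin d)}
    (hσ : σ ∈ permsOn C) :
    ∑ r, b r * f r < ∑ r, b r * f (σ r) ∨
      ∃ τ ∈ youngSubgroup b, τ ∈ permsOn C ∧ f ∘ σ = f ∘ τ := by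
  have hsupp : {x | σ x ≠ x} ⊆ (C : Set (Fin d)) := fun x hx => (mem_of_mem_permsOn hσ hx).1
  rw [or_iff_not_imp_right]
  intro hne
  have hlt := hf.sum_mul_lt_sum_comp_perm_mul_iff hsupp |>.2 fun hfσ =>
    hne (exists_comp_eq_of_antivaryOn hj hC hf hσ hfσ)
  have houtside : ∑ r ∈ Cᶜ, b r * f (σ r) = ∑ r ∈ Cᶜ, b r * f r :=
    Finset.sum_congr rfl fun r hr => by
      rw [mem_permsOn.1 hσ r (Finset.mem_compl.1 hr)]
  rw [← Finset.sum_add_sum_compl C, ← Finset.sum_add_sum_compl C fun r => b r * f (σ r),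
    houtside]
  simpa only [mul_comm (b _), add_lt_add_iff_right] using hlt

end Rearrangement

/-! ### Semistandard words -/

section Semistandard

variable {ι : Type*} {d : ℕ}

/-- The statistic of words that increases under straightening (for `b` the columns) and makes the
pairing of signed orbit sums triangular (for `b` the rows). -/
def weightedRank (rk : ι → ℕ) (b : Fin d → ℕ) (w : Fin d → ι) : ℕ := ∑ r, b r * rk (w r)

theorem weightedRank_comp {rk : ι → ℕ} {b : Fin d → ℕ} {τ : Equiv.Perm (Fin d)}
    (hτ : τ ∈ youngSubgroup b) (w : Fin d → ι) :
    weightedRank rk b (w ∘ τ) = weightedRank rk b w :=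
  sum_mul_comp_of_mem_youngSubgroup (f := rk ∘ w) hτ

/-- Within each block of `b`, ordered by `o`, the letters of `w` weakly increase, and only even
letters are repeated. Taking `p + 1` for `p` allows repetitions of odd letters instead. -/
def BlockOrdered {α : Type*} (p : ι → ZMod 2) (rk : ι → ℕ) (b o : α → ℕ) (w : α → ι) : Prop :=
  ∀ r s, b r = b s → o r < o s → rk (w r) < rk (w s) ∨ w r = w s ∧ p (w r) = 0

section BlockOrdered

variable {p : ι → ZMod 2} {rk : ι → ℕ} {b o : Fin d → ℕ} {w : Fin d → ι}

theorem BlockOrdered.isBlockSorted (hw : BlockOrdered p rk b o w) :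
    IsBlockSorted b o (rk ∘ w) := fun r s hb ho =>
  (hw r s hb ho).elim le_of_lt fun h => (congr_arg rk h.1).le

theorem BlockOrdered.parity_eq_zero (hinj : ∀ r s, b r = b s → o r = o s → r = s)
    (hw : BlockOrdered p rk b o w) {r s : Fin d} (hb : b r = b s) (hne : r ≠ s)
    (heq : w r = w s) : p (w r) = 0 := by
  rcases lt_trichotomy (o r) (o s) with ho | ho | ho
  · exact (hw r s hb ho).elim (fun h => absurd (congr_arg rk heq) h.ne) And.right
  · exact absurd (hinj r s hb ho) hne
  · exact (hw s r hb.symm ho).elim (fun h => absurd (congr_arg rk heq) h.ne')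
      fun h => heq ▸ h.2

theorem BlockOrdered.apply_eq_self (hinj : ∀ r s, b r = b s → o r = o s → r = s)
    (hw : BlockOrdered p rk b o w) {σ : Equiv.Perm (Fin d)} (hσ : σ ∈ youngSubgroup b)
    (hfix : w ∘ σ = w) {r : Fin d} (hr : p (w r) ≠ 0) : σ r = r :=
  by_contra fun hne =>
    hr (hw.parity_eq_zero hinj (hσ r).symm (Ne.symm hne) (congr_fun hfix r).symm)

end BlockOrdered

/-- The semistandard words, the letter at position `r` being placed in the cell
`(row r, col r)`: letters weakly increase along rows and down columns, only even letters are
repeated in a row, and only odd letters are repeated in a column. -/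
structure Semistandard {α : Type*} (p : ι → ZMod 2) (rk : ι → ℕ) (row col : α → ℕ)
    (w : α → ι) : Prop where
  rows : BlockOrdered p rk row col w
  cols : BlockOrdered (fun a => p a + 1) rk col row w

variable {p : ι → ZMod 2} {rk : ι → ℕ} {row col : Fin d → ℕ} {u w : Fin d → ι}

theorem Semistandard.admissible_row (hinj : ∀ r s, row r = row s → col r = col s → r = s)
    (hw : Semistandard p rk row col w) : Admissible (superSign p) (youngSubgroup row) w :=
  fun _ hσ hfix =>
    superSign_eq_one_of_fixes_odd fun _ hr => hw.rows.apply_eq_self hinj hσ hfix hr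

theorem Semistandard.admissible_col
    (hinj : ∀ r s, row r = row s → col r = col s → r = s) (hw : Semistandard p rk row col w) :
    Admissible (twistedSign p) (youngSubgroup col) w := fun _ hσ hfix =>
  twistedSign_eq_one_of_fixes_even hfix fun _ hr =>
    hw.cols.apply_eq_self (fun r s hcol hrow => hinj r s hrow hcol) hσ hfix (by simp [hr])

theorem weightedRank_le_of_comp_eq (hinj : ∀ r s, row r = row s → col r = col s → r = s)
    (hw : IsBlockSorted col row (rk ∘ w)) {ρ τ : Equiv.Perm (Fin d)}
    (hρ : ρ ∈ youngSubgroup row) (hτ : τ ∈ youngSubgroup col) (h : u ∘ ρ = w ∘ τ) :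
    weightedRank rk row u ≤ weightedRank rk row w := by
  rw [← weightedRank_comp hρ u, h]
  exact hw.sum_mul_comp_le (fun r s hcol hrow => hinj r s hrow hcol) hτ

theorem Semistandard.eq_of_comp_eq (hrk : Function.Injective rk)
    (hinj : ∀ r s, row r = row s → col r = col s → r = s)
    (hu : Semistandard p rk row col u) (hw : Semistandard p rk row col w)
    {ρ τ : Equiv.Perm (Fin d)} (hρ : ρ ∈ youngSubgroup row) (hτ : τ ∈ youngSubgroup col)
    (h : u ∘ ρ = w ∘ τ) (hrank : weightedRank rk row u = weightedRank rk row w) :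
    u = w ∧ w ∘ τ = w := by
  rw [← weightedRank_comp hρ u, h] at hrank
  have hwτ : w ∘ τ = w := hrk.comp_left <| hw.cols.isBlockSorted.comp_eq_of_sum_mul_eq
    (fun r s hcol hrow => hinj r s hrow hcol) hτ hrank
  have huρ : u ∘ ρ = u := hrk.comp_left <| hu.rows.isBlockSorted.comp_eq hinj hρ <| by
    rw [Function.comp_assoc, h, hwτ]
    exact hw.rows.isBlockSorted
  exact ⟨by rw [← huρ, h, hwτ], hwτ⟩

end Semistandard

/-! ### The pairing of row orbits with column orbits -/

section OrbitPairing

variable {ι : Type*} {d : ℕ} {p : ι → ZMod 2} {rk : ι → ℕ} {row col : Fin d → ℕ}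
  {u w : Fin d → ι}

theorem exists_comp_eq_comp_of_mul_orbitCoeff_ne_zero {v : Fin d → ι}
    (h : orbitCoeff (superSign p) (youngSubgroup row) u v *
      orbitCoeff (twistedSign p) (youngSubgroup col) w v ≠ 0) :
    ∃ ρ ∈ youngSubgroup row, ∃ τ ∈ youngSubgroup col, u ∘ ρ = v ∧ w ∘ τ = v := by
  obtain ⟨ρ, hρ, hu⟩ := exists_of_orbitCoeff_ne_zero (left_ne_zero_of_mul h)
  obtain ⟨τ, hτ, hw⟩ := exists_of_orbitCoeff_ne_zero (right_ne_zero_of_mul h)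
  exact ⟨ρ, hρ, τ, hτ, hu, hw⟩

variable [Fintype ι]

variable (p row col) in
/-- The pairing of the signed sum over the row orbit of `u` with the twisted signed sum over the
column orbit of `w`. -/
def orbitPairing (u w : Fin d → ι) : ℤ :=
  ∑ v, orbitCoeff (superSign p) (youngSubgroup row) u v *
    orbitCoeff (twistedSign p) (youngSubgroup col) w v

theorem Semistandard.orbitPairing_self (hrk : Function.Injective rk)
    (hinj : ∀ r s, row r = row s → col r = col s → r = s)
    (hw : Semistandard p rk row col w) : orbitPairing p row col w w = 1 := by
  rw [orbitPairing, Finset.sum_eq_single w _ (by simp),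
    orbitCoeff_self (isSignCocycle_superSign p) (hw.admissible_row hinj),
    orbitCoeff_self (isSignCocycle_twistedSign p) (hw.admissible_col hinj), one_mul]
  intro v _ hv
  by_contra hne
  obtain ⟨ρ, hρ, τ, hτ, hwρ, hwτ⟩ := exists_comp_eq_comp_of_mul_orbitCoeff_ne_zero hne
  exact hv (hwτ.symm.trans (hw.eq_of_comp_eq hrk hinj hw hρ hτ (hwρ.trans hwτ.symm) rfl).2)

theorem Semistandard.rank_lt_or_eq_of_orbitPairing_ne_zero (hrk : Function.Injective rk)
    (hinj : ∀ r s, row r = row s → col r = col s → r = s)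
    (hu : Semistandard p rk row col u) (hw : Semistandard p rk row col w)
    (h : orbitPairing p row col u w ≠ 0) :
    weightedRank rk row u < weightedRank rk row w ∨ u = w := by
  obtain ⟨v, -, hv⟩ := Finset.exists_ne_zero_of_sum_ne_zero h
  obtain ⟨ρ, hρ, τ, hτ, huρ, hwτ⟩ := exists_comp_eq_comp_of_mul_orbitCoeff_ne_zero hv
  have hcomp := huρ.trans hwτ.symm
  exact (weightedRank_le_of_comp_eq hinj hw.cols.isBlockSorted hρ hτ hcomp).lt_or_eq.imp_right
    fun hrank => (hu.eq_of_comp_eq hrk hinj hw hρ hτ hcomp hrank).1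

theorem det_eq_one_of_unitriangular {S R : Type*} [Fintype S] [DecidableEq S] [CommRing R]
    (A : Matrix S S R) (rank : S → ℕ) (hdiag : ∀ s, A s s = 1)
    (htri : ∀ s t, A s t ≠ 0 → rank s < rank t ∨ s = t) : A.det = 1 := by
  let e := Fintype.equivFin S
  let _ : LinearOrder S := LinearOrder.lift' (fun s => toLex (rank s, e s)) fun s t h =>
    e.injective (congr_arg Prod.snd (toLex.injective h))
  have hupper : A.IsUpperTriangular := by
    intro s t hlt
    by_contra hne
    have hrank : toLex (rank t, e t) < toLex (rank s, e s) := hlt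
    rw [Prod.Lex.toLex_lt_toLex] at hrank
    rcases htri s t hne with hst | rfl
    · omega
    · simp at hrank
  have hdet := Matrix.det_of_isUpperTriangular hupper
  simp only [hdiag, Finset.prod_const_one] at hdet
  convert hdet

theorem det_orbitPairing [Fintype {w // Semistandard p rk row col w}]
    [DecidableEq {w // Semistandard p rk row col w}] (hrk : Function.Injective rk)
    (hinj : ∀ r s, row r = row s → col r = col s → r = s) :
    (Matrix.of fun u w : {w // Semistandard p rk row col w} =>
      orbitPairing p row col u.1 w.1).det = 1 :=
  det_eq_one_of_unitriangular _ (fun w => weightedRank rk row w.1)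
    (fun w => w.2.orbitPairing_self hrk hinj) fun u w h =>
      (u.2.rank_lt_or_eq_of_orbitPairing_ne_zero hrk hinj w.2 h).imp_right Subtype.ext

end OrbitPairing

/-! ### Column sums and Garnir relations -/

section Garnir

theorem intCast_units_mul_self {R : Type*} [Ring R] (x : ℤˣ) :
    ((x : ℤ) : R) * ((x : ℤ) : R) = 1 := by
  rw [← Int.cast_mul, ← Units.val_mul, Int.units_mul_self, Units.val_one, Int.cast_one]

instance {d : ℕ} (b : Fin d → ℕ) : DecidablePred (· ∈ youngSubgroup b) :=
  fun σ => inferInstanceAs (Decidable (∀ r, b (σ r) = b r))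

instance {α : Type*} [Fintype α] [DecidableEq α] (C : Finset α) :
    DecidablePred (· ∈ permsOn C) :=
  fun _ => decidable_of_iff' _ mem_permsOn

variable {ι : Type*} {d : ℕ} (p : ι → ZMod 2) (row col : Fin d → ℕ)

/-- The twisted signed sum over the column group applied to a word, as a functional on the
row equivariant functions. -/
def columnSum (w : Fin d → ι) :
    Module.Dual ℚ (equivariantFunctions ℚ (superSign p) (youngSubgroup row)) :=
  ∑ τ : youngSubgroup col, ((twistedSign p w τ : ℤ) : ℚ) •
    (LinearMap.proj (w ∘ (τ : Equiv.Perm (Fin d))) ∘ₗ Submodule.subtype _)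

variable {p row col} {w : Fin d → ι}

theorem columnSum_apply (g : equivariantFunctions ℚ (superSign p) (youngSubgroup row)) :
    columnSum p row col w g = ∑ τ : youngSubgroup col,
      ((twistedSign p w τ : ℤ) : ℚ) * g.1 (w ∘ (τ : Equiv.Perm (Fin d))) := by
  simp [columnSum]

theorem twistedSign_swap_mul_apply {g : (Fin d → ι) → ℚ}
    (hg : g ∈ equivariantFunctions ℚ (superSign p) (youngSubgroup row)) {r s : Fin d}
    (hrs : r ≠ s) (hrow : row r = row s) (v : Fin d → ι) :
    ((twistedSign p v (Equiv.swap r s) : ℤ) : ℚ) * g (v ∘ Equiv.swap r s) = -g v := by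
  rw [hg v _ (swap_mem_youngSubgroup hrow), twistedSign, Equiv.Perm.sign_swap hrs]
  push_cast
  linear_combination -g v * intCast_units_mul_self (R := ℚ) (superSign p v (Equiv.swap r s))

theorem not_admissible_of_repeated_even {r s : Fin d} (hrs : r ≠ s) (hcol : col r = col s)
    (heq : w r = w s) (hp : p (w r) = 0) :
    ¬ Admissible (twistedSign p) (youngSubgroup col) w := by
  intro hadm
  have hfix : w ∘ Equiv.swap r s = w := by
    rw [Equiv.comp_swap_eq_update, heq, Function.update_eq_self, ← heq, Function.update_eq_self]
  have hsuper : superSign p w (Equiv.swap r s) = 1 :=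
    superSign_eq_one_of_fixes_odd fun x hx => Equiv.swap_apply_of_ne_of_ne
      (fun h => hx (h ▸ hp)) fun h => hx (h ▸ heq ▸ hp)
  have hsign := hadm _ (swap_mem_youngSubgroup hcol) hfix
  rw [twistedSign, hsuper, Equiv.Perm.sign_swap hrs] at hsign
  exact absurd hsign (by decide)

theorem columnSum_comp (w : Fin d → ι) {π : Equiv.Perm (Fin d)} (hπ : π ∈ youngSubgroup col) :
    columnSum p row col (w ∘ π) = ((twistedSign p w π : ℤ) : ℚ) • columnSum p row col w := by
  ext g
  rw [LinearMap.smul_apply, columnSum_apply, columnSum_apply, smul_eq_mul, Finset.mul_sum]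
  refine Fintype.sum_equiv (Equiv.mulLeft ⟨π, hπ⟩) _ _ fun τ => ?_
  rw [Equiv.coe_mulLeft, Subgroup.coe_mul, isSignCocycle_twistedSign p w, Equiv.Perm.coe_mul,
    Function.comp_assoc, Units.val_mul, Int.cast_mul]
  linear_combination -((twistedSign p (w ∘ π) τ : ℤ) : ℚ) * g.1 (w ∘ π ∘ (τ : Equiv.Perm _)) *
    intCast_units_mul_self (R := ℚ) (twistedSign p w π)

theorem twistedSign_smul_columnSum_comp {π : Equiv.Perm (Fin d)} (hπ : π ∈ youngSubgroup col) :
    ((twistedSign p w π : ℤ) : ℚ) • columnSum p row col (w ∘ π) = columnSum p row col w := by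
  rw [columnSum_comp w hπ, smul_smul, intCast_units_mul_self, one_smul]

theorem columnSum_eq_zero_of_not_admissible
    (hw : ¬ Admissible (twistedSign p) (youngSubgroup col) w) : columnSum p row col w = 0 := by
  simp only [Admissible, not_forall] at hw
  obtain ⟨τ, hτ, hfix, hsign⟩ := hw
  have hcomp := columnSum_comp (p := p) (row := row) w hτ
  rw [hfix, (Int.units_eq_one_or _).resolve_left hsign, Units.val_neg, Units.val_one,
    Int.cast_neg, Int.cast_one, neg_smul, one_smul] at hcomp
  ext g
  exact self_eq_neg.1 (LinearMap.congr_fun hcomp g)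

/-- Two positions of `C` brought into a common row by a column permutation can be exchanged, which
matches the terms of the sum over `permsOn C` in cancelling pairs. -/
theorem garnir_relation {C : Finset (Fin d)}
    (hC : ∀ τ ∈ youngSubgroup col, ∃ r s, r ≠ s ∧ row r = row s ∧ τ r ∈ C ∧ τ s ∈ C)
    (w : Fin d → ι) :
    ∑ σ : permsOn C, ((twistedSign p w σ : ℤ) : ℚ) •
      columnSum p row col (w ∘ (σ : Equiv.Perm (Fin d))) = 0 := by
  ext g
  simp only [LinearMap.sum_apply, LinearMap.smul_apply, columnSum_apply, smul_eq_mul,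
    Finset.mul_sum, LinearMap.zero_apply]
  rw [Finset.sum_comm]
  refine Finset.sum_eq_zero fun ⟨τ, hτ⟩ _ => ?_
  obtain ⟨r, s, hrs, hrow, hr, hs⟩ := hC τ hτ
  have hterm : ∀ σ : permsOn C, ((twistedSign p w σ : ℤ) : ℚ) *
      (((twistedSign p (w ∘ (σ : Equiv.Perm (Fin d))) τ : ℤ) : ℚ) * g.1 ((w ∘ σ.1) ∘ τ)) =
      ((twistedSign p w (σ * τ) : ℤ) : ℚ) * g.1 (w ∘ (σ * τ : Equiv.Perm (Fin d))) := fun σ => by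
    rw [isSignCocycle_twistedSign p w, Equiv.Perm.coe_mul, Function.comp_assoc, Units.val_mul,
      Int.cast_mul, mul_assoc]
  simp only [hterm]
  refine self_eq_neg.1 ?_
  rw [← Finset.sum_neg_distrib]
  refine Fintype.sum_equiv (Equiv.mulRight ⟨Equiv.swap (τ r) (τ s), swap_mem_permsOn hr hs⟩)
    _ _ fun σ => ?_
  rw [Equiv.coe_mulRight, Subgroup.coe_mul, mul_assoc, ← Equiv.mul_swap_eq_swap_mul, ← mul_assoc,
    isSignCocycle_twistedSign p w (σ * τ), Equiv.Perm.coe_mul (σ * τ : Equiv.Perm (Fin d)),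
    ← Function.comp_assoc, Units.val_mul, Int.cast_mul, mul_assoc,
    twistedSign_swap_mul_apply g.2 hrs hrow, mul_neg, neg_neg]

theorem admissible_permsOn {C : Finset (Fin d)}
    (hodd : ∀ r ∈ C, ∀ s ∈ C, r ≠ s → w r = w s → p (w r) ≠ 0) :
    Admissible (twistedSign p) (permsOn C) w := by
  refine fun σ hσ hfix => twistedSign_eq_one_of_fixes_even hfix fun r hr => ?_
  by_contra hne
  obtain ⟨hrC, hσrC⟩ := mem_of_mem_permsOn hσ hne
  exact hodd r hrC _ hσrC (Ne.symm hne) (congr_fun hfix r).symm hr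

/-- A Garnir relation whose lowest terms are all equal to `columnSum p row col w` expresses it
through words with a larger statistic. -/
theorem columnSum_mem_of_garnir {rk : ι → ℕ} (hrk : Function.Injective rk) {C : Finset (Fin d)}
    {j j' : ℕ} (hj : j < j') (hCcol : ∀ r ∈ C, col r = j ∨ col r = j')
    (hC : ∀ τ ∈ youngSubgroup col, ∃ r s, r ≠ s ∧ row r = row s ∧ τ r ∈ C ∧ τ s ∈ C)
    (hanti : AntivaryOn (rk ∘ w) col C) (hadm : Admissible (twistedSign p) (permsOn C) w)
    {N : Submodule ℚ
      (Module.Dual ℚ (equivariantFunctions ℚ (superSign p) (youngSubgroup row)))}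
    (hN : ∀ v, weightedRank rk col w < weightedRank rk col v → columnSum p row col v ∈ N) :
    columnSum p row col w ∈ N := by
  have hlow : ∀ σ : permsOn C,
      ¬ weightedRank rk col w < weightedRank rk col (w ∘ (σ : Equiv.Perm (Fin d))) →
      ((twistedSign p w σ : ℤ) : ℚ) • columnSum p row col (w ∘ (σ : Equiv.Perm (Fin d))) =
        columnSum p row col w := by
    rintro ⟨σ, hσ⟩ hle
    obtain ⟨τ, hτ, hτC, heq⟩ :=
      (sum_mul_lt_or_exists_comp_eq hj hCcol hanti hσ).resolve_left hle
    have hwσ : w ∘ σ = w ∘ τ := hrk.comp_left heq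
    rw [hadm.eq_of_comp_eq (isSignCocycle_twistedSign p) hσ hτC hwσ, hwσ,
      twistedSign_smul_columnSum_comp hτ]
  have hsplit := Finset.sum_filter_add_sum_filter_not Finset.univ
    (fun σ : permsOn C =>
      weightedRank rk col w < weightedRank rk col (w ∘ (σ : Equiv.Perm (Fin d))))
    fun σ => ((twistedSign p w σ : ℤ) : ℚ) •
      columnSum p row col (w ∘ (σ : Equiv.Perm (Fin d)))
  rw [garnir_relation hC w,
    Finset.sum_congr rfl fun σ hσ => hlow σ (Finset.mem_filter.1 hσ).2,
    Finset.sum_const, ← Nat.cast_smul_eq_nsmul ℚ, add_eq_zero_iff_neg_eq] at hsplit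
  refine (N.smul_mem_iff (Nat.cast_ne_zero.2 (Finset.card_ne_zero.2 ⟨1, ?_⟩))).1
    (hsplit ▸ N.neg_mem (N.sum_mem fun σ hσ => N.smul_mem _ (hN _ (Finset.mem_filter.1 hσ).2)))
  simp

end Garnir

/-! ### Straightening -/

section Straightening

variable (lam : YoungDiagram)

/-- The column of the cell at a position of the row reading; its row is `rowBlock`. -/
def cellCol (r : Fin lam.card) : ℕ := (rowReading lam r).1.2

variable {lam}

theorem position_ext (r s : Fin lam.card) (hrow : rowBlock lam r = rowBlock lam s)
    (hcol : cellCol lam r = cellCol lam s) : r = s :=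
  (rowReading lam).injective (Subtype.ext (Prod.ext hrow hcol))

theorem position_ext_of_col (r s : Fin lam.card) (hcol : cellCol lam r = cellCol lam s)
    (hrow : rowBlock lam r = rowBlock lam s) : r = s :=
  position_ext r s hrow hcol

theorem cell_mem (r : Fin lam.card) : (rowBlock lam r, cellCol lam r) ∈ lam :=
  (YoungDiagram.mem_cells _).1 (rowReading lam r).2

theorem exists_position {i j : ℕ} (h : (i, j) ∈ lam) :
    ∃ r, rowBlock lam r = i ∧ cellCol lam r = j := by
  refine ⟨(rowReading lam).symm ⟨(i, j), (YoungDiagram.mem_cells _).2 h⟩, ?_, ?_⟩ <;>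
    simp [rowBlock, cellCol]

variable (lam) in
/-- The Garnir set: the positions in column `j` from row `i` on, and those in column `j'` up to
row `i`. -/
def garnirSet (i j j' : ℕ) : Finset (Fin lam.card) :=
  {r | cellCol lam r = j ∧ i ≤ rowBlock lam r ∨ cellCol lam r = j' ∧ rowBlock lam r ≤ i}

theorem mem_garnirSet {i j j' : ℕ} {r : Fin lam.card} : r ∈ garnirSet lam i j j' ↔
    cellCol lam r = j ∧ i ≤ rowBlock lam r ∨ cellCol lam r = j' ∧ rowBlock lam r ≤ i := by
  simp [garnirSet]

theorem colLen_lt_card_garnirSet {i j j' : ℕ} (hj : j < j') (hij : (i, j') ∈ lam) :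
    lam.colLen j < (garnirSet lam i j j').card := by
  suffices hcover : Finset.range (lam.colLen j + 1) ⊆ (garnirSet lam i j j').image fun r =>
      if cellCol lam r = j then rowBlock lam r + 1 else rowBlock lam r by
    exact (Finset.card_range _).ge.trans ((Finset.card_le_card hcover).trans Finset.card_image_le)
  intro t ht
  rw [Finset.mem_image]
  rcases le_or_gt t i with hti | hti
  · obtain ⟨r, hrow, hcol⟩ := exists_position (lam.up_left_mem hti le_rfl hij)
    exact ⟨r, mem_garnirSet.2 (by omega), by rw [if_neg (by omega), hrow]⟩
  · obtain ⟨r, hrow, hcol⟩ := exists_position (lam := lam) (i := t - 1) (j := j)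
      (YoungDiagram.mem_iff_lt_colLen.2 (by rw [Finset.mem_range] at ht; omega))
    exact ⟨r, mem_garnirSet.2 (by omega), by rw [if_pos hcol]; omega⟩

theorem rowBlock_lt_colLen_of_mem_garnirSet {i j j' : ℕ} (hj : j < j')
    {τ : Equiv.Perm (Fin lam.card)} (hτ : τ ∈ youngSubgroup (cellCol lam)) {r : Fin lam.card}
    (hr : τ r ∈ garnirSet lam i j j') : rowBlock lam r < lam.colLen j := by
  have hmem := YoungDiagram.mem_iff_lt_colLen.1 (cell_mem r)
  have hanti := lam.colLen_anti j j' hj.le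
  rw [mem_garnirSet, hτ r] at hr
  rcases hr with ⟨hcol, -⟩ | ⟨hcol, -⟩ <;> rw [hcol] at hmem <;> omega

theorem exists_row_eq_of_garnirSet {i j j' : ℕ} (hj : j < j') (hij : (i, j') ∈ lam)
    (τ : Equiv.Perm (Fin lam.card)) (hτ : τ ∈ youngSubgroup (cellCol lam)) :
    ∃ r s, r ≠ s ∧ rowBlock lam r = rowBlock lam s ∧
      τ r ∈ garnirSet lam i j j' ∧ τ s ∈ garnirSet lam i j j' := by
  have hcard : (Finset.range (lam.colLen j)).card <
      ((garnirSet lam i j j').map τ.symm.toEmbedding).card := by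
    rw [Finset.card_range, Finset.card_map]
    exact colLen_lt_card_garnirSet hj hij
  obtain ⟨r, hr, s, hs, hne, hrow⟩ := Finset.exists_ne_map_eq_of_card_lt_of_maps_to hcard
    (f := rowBlock lam) fun r hr => Finset.mem_coe.2 <| Finset.mem_range.2 <|
      rowBlock_lt_colLen_of_mem_garnirSet hj hτ (Finset.mem_map_equiv.1 hr)
  exact ⟨r, s, hne, hrow, Finset.mem_map_equiv.1 hr, Finset.mem_map_equiv.1 hs⟩

variable {ι : Type*} {p : ι → ZMod 2} {rk : ι → ℕ} {w : Fin lam.card → ι}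
  {r₀ s₀ r s : Fin lam.card}

theorem IsBlockSorted.le_of_le {f : Fin lam.card → ℕ}
    (hf : IsBlockSorted (cellCol lam) (rowBlock lam) f) (hcol : cellCol lam r = cellCol lam s)
    (hrow : rowBlock lam r ≤ rowBlock lam s) : f r ≤ f s := by
  rcases hrow.lt_or_eq with hlt | heq
  · exact hf r s hcol hlt
  · rw [position_ext r s heq hcol]

theorem IsBlockSorted.le_of_mem_garnirSet {f : Fin lam.card → ℕ}
    (hf : IsBlockSorted (cellCol lam) (rowBlock lam) f)
    (hrow : rowBlock lam r₀ = rowBlock lam s₀)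
    (hr : r ∈ garnirSet lam (rowBlock lam r₀) (cellCol lam r₀) (cellCol lam s₀))
    (hs : s ∈ garnirSet lam (rowBlock lam r₀) (cellCol lam r₀) (cellCol lam s₀))
    (hcol : cellCol lam r₀ < cellCol lam s₀) (hrs : cellCol lam r < cellCol lam s) :
    f r₀ ≤ f r ∧ f s ≤ f s₀ := by
  rw [mem_garnirSet] at hr hs
  exact ⟨hf.le_of_le (by omega) (by omega), hf.le_of_le (by omega) (by omega)⟩

theorem parity_ne_zero_of_mem_garnirSet (hrk : Function.Injective rk)
    (hw : BlockOrdered (fun a => p a + 1) rk (cellCol lam) (rowBlock lam) w)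
    (hrow : rowBlock lam r₀ = rowBlock lam s₀) (hcol : cellCol lam r₀ < cellCol lam s₀)
    (hrank : rk (w s₀) ≤ rk (w r₀)) (hodd : w r₀ = w s₀ → p (w r₀) ≠ 0)
    (hr : r ∈ garnirSet lam (rowBlock lam r₀) (cellCol lam r₀) (cellCol lam s₀))
    (hs : s ∈ garnirSet lam (rowBlock lam r₀) (cellCol lam r₀) (cellCol lam s₀))
    (hne : r ≠ s) (heq : w r = w s) : p (w r) ≠ 0 := by
  wlog hle : cellCol lam r ≤ cellCol lam s generalizing r s
  · exact heq ▸ this hs hr hne.symm heq.symm (le_of_not_ge hle)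
  rcases hle.eq_or_lt with hrs | hrs
  · intro hp
    simpa [hp] using hw.parity_eq_zero position_ext_of_col hrs hne heq
  · obtain ⟨hr₀, hs₀⟩ := hw.isBlockSorted.le_of_mem_garnirSet hrow hr hs hcol hrs
    simp only [Function.comp_apply, ← heq] at hr₀ hs₀
    have hwr₀ : w r₀ = w r := hrk (by omega)
    have hws₀ : w r = w s₀ := hrk (by omega)
    exact hwr₀ ▸ hodd (hwr₀.trans hws₀)

theorem columnSum_mem_of_violation (hrk : Function.Injective rk)
    (hw : BlockOrdered (fun a => p a + 1) rk (cellCol lam) (rowBlock lam) w)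
    (hrow : rowBlock lam r₀ = rowBlock lam s₀) (hcol : cellCol lam r₀ < cellCol lam s₀)
    (hrank : rk (w s₀) ≤ rk (w r₀)) (hodd : w r₀ = w s₀ → p (w r₀) ≠ 0)
    {N : Submodule ℚ
      (Module.Dual ℚ (equivariantFunctions ℚ (superSign p) (youngSubgroup (rowBlock lam))))}
    (hN : ∀ v, weightedRank rk (cellCol lam) w < weightedRank rk (cellCol lam) v →
      columnSum p (rowBlock lam) (cellCol lam) v ∈ N) :
    columnSum p (rowBlock lam) (cellCol lam) w ∈ N := by
  refine columnSum_mem_of_garnir hrk hcol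
    (C := garnirSet lam (rowBlock lam r₀) (cellCol lam r₀) (cellCol lam s₀))
    (fun r hr => (mem_garnirSet.1 hr).imp And.left And.left)
    (exists_row_eq_of_garnirSet hcol (hrow ▸ cell_mem s₀)) (fun r hr s hs hrs => ?_)
    (admissible_permsOn fun r hr s hs hne heq =>
      parity_ne_zero_of_mem_garnirSet hrk hw hrow hcol hrank hodd hr hs hne heq) hN
  obtain ⟨hr₀, hs₀⟩ := hw.isBlockSorted.le_of_mem_garnirSet hrow hr hs hcol hrs
  exact hs₀.trans (hrank.trans hr₀)

theorem exists_blockOrdered_comp_or_columnSum_eq_zero (hrk : Function.Injective rk)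
    (w : Fin lam.card → ι) :
    ∃ τ ∈ youngSubgroup (cellCol lam),
      BlockOrdered (fun a => p a + 1) rk (cellCol lam) (rowBlock lam) (w ∘ τ) ∨
        columnSum p (rowBlock lam) (cellCol lam) (w ∘ τ) = 0 := by
  obtain ⟨τ, hτ, hsort⟩ := exists_isBlockSorted_comp (cellCol lam) (rowBlock lam) (rk ∘ w)
  refine ⟨τ, hτ, or_iff_not_imp_left.2 fun hord => ?_⟩
  simp only [BlockOrdered, not_forall, not_or, not_and] at hord
  obtain ⟨r, s, hcol, hrow, hge, heven⟩ := hord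
  have heq : (w ∘ τ) r = (w ∘ τ) s := hrk ((hsort r s hcol hrow).antisymm (not_lt.1 hge))
  exact columnSum_eq_zero_of_not_admissible <| not_admissible_of_repeated_even
    (ne_of_apply_ne _ hrow.ne) hcol heq (parity_eq_zero_of_add_one_ne_zero (heven heq))

theorem columnSum_mem_span [Finite ι] (hrk : Function.Injective rk) (w : Fin lam.card → ι) :
    columnSum p (rowBlock lam) (cellCol lam) w ∈ Submodule.span ℚ (Set.range
      fun S : {S // Semistandard p rk (rowBlock lam) (cellCol lam) S} =>
        columnSum p (rowBlock lam) (cellCol lam) S.1) := by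
  have : Finite (Set.range (weightedRank (ι := ι) rk (cellCol lam))) := Set.finite_range _
  have hwf := InvImage.wf (Set.rangeFactorization (weightedRank (ι := ι) rk (cellCol lam)))
    (wellFounded_gt (α := Set.range (weightedRank rk (cellCol lam))))
  induction w using hwf.induction with
  | _ w ih =>
  obtain ⟨τ, hτ, hcols | hzero⟩ := exists_blockOrdered_comp_or_columnSum_eq_zero (p := p) hrk w
  all_goals rw [← twistedSign_smul_columnSum_comp hτ]; refine Submodule.smul_mem _ _ ?_
  · by_cases hrows : BlockOrdered p rk (rowBlock lam) (cellCol lam) (w ∘ τ)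
    · exact Submodule.subset_span ⟨⟨w ∘ τ, hrows, hcols⟩, rfl⟩
    simp only [BlockOrdered, not_forall, not_or, not_and] at hrows
    obtain ⟨r, s, hrow, hcol, hge, hodd⟩ := hrows
    exact columnSum_mem_of_violation hrk hcols hrow hcol (not_lt.1 hge) hodd fun v hv =>
      ih v ((weightedRank_comp hτ w).symm.trans_lt hv)
  · rw [hzero]
    exact Submodule.zero_mem _

end Straightening

/-! ### Integrality -/

section Integrality

theorem card_comp_eq_comp {α ι : Type*} [DecidableEq (α → ι)] {H : Subgroup (Equiv.Perm α)}
    [Fintype H] (u : α → ι) (σ : H) :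
    (Finset.univ.filter fun τ : H => u ∘ τ.1 = u ∘ σ.1).card =
      (Finset.univ.filter fun τ : H => u ∘ τ.1 = u).card := by
  refine Finset.card_equiv (Equiv.mulRight σ⁻¹) fun τ => ?_
  simp only [Finset.mem_filter_univ, Equiv.coe_mulRight, Subgroup.coe_mul, Subgroup.coe_inv,
    Equiv.Perm.coe_mul, ← Function.comp_assoc]
  refine ⟨fun h => by rw [h, comp_comp_inv], fun h => ?_⟩
  rw [← comp_comp_inv (u ∘ τ.1) σ.1⁻¹, h, inv_inv]

theorem sum_units_mul_comp_eq_card_mul {α ι R : Type*} [Fintype (α → ι)] [DecidableEq (α → ι)]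
    [CommRing R] {χ : (α → ι) → Equiv.Perm α → ℤˣ} (hχ : IsSignCocycle χ)
    {H : Subgroup (Equiv.Perm α)} [Fintype H] {u : α → ι} (hu : Admissible χ H u)
    (g : (α → ι) → R) :
    ∑ τ : H, ((χ u τ : ℤ) : R) * g (u ∘ τ.1) =
      (Finset.univ.filter fun τ : H => u ∘ τ.1 = u).card *
        ∑ v, (orbitCoeff χ H u v : R) * g v := by
  have hterm : ∀ τ ∈ (Finset.univ : Finset H), ((χ u τ : ℤ) : R) * g (u ∘ τ.1) =
      (fun v => (orbitCoeff χ H u v : R) * g v) (u ∘ τ.1) := fun τ _ => by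
    beta_reduce
    rw [orbitCoeff_comp hχ hu τ.2]
  rw [Finset.sum_congr rfl hterm, ← Finset.sum_fiberwise' _ (fun τ : H => u ∘ τ.1)
    fun v => (orbitCoeff χ H u v : R) * g v, Finset.mul_sum]
  refine Finset.sum_congr rfl fun v _ => ?_
  rw [Finset.sum_const, nsmul_eq_mul]
  by_cases hv : orbitCoeff χ H u v = 0
  · simp [hv]
  · obtain ⟨σ, hσ, rfl⟩ := exists_of_orbitCoeff_ne_zero hv
    rw [card_comp_eq_comp u ⟨σ, hσ⟩]

theorem exists_int_combination {U S : Type*} [Fintype S] [DecidableEq S] {A : Matrix U S ℤ}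
    {f : S → U} (hdet : (A.submatrix f id).det = 1) {b : U → ℤ} {c : S → ℚ}
    (hc : ∀ u, (b u : ℚ) = ∑ s, c s * A u s) : ∃ q : S → ℤ, ∀ u, b u = ∑ s, q s * A u s := by
  set M := A.submatrix f id with hM
  have hb : ((Int.castRingHom ℚ).mapMatrix M).mulVec c = Int.castRingHom ℚ ∘ b ∘ f := by
    ext s
    simp only [hM, Matrix.mulVec, dotProduct, RingHom.mapMatrix_apply, Matrix.map_apply,
      Matrix.submatrix_apply, id_eq, eq_intCast, Function.comp_apply, hc, mul_comm]
  have hq : c = Int.castRingHom ℚ ∘ M.adjugate.mulVec (b ∘ f) := calc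
    c = ((Int.castRingHom ℚ).mapMatrix (M.adjugate * M)).mulVec c := by
      rw [Matrix.adjugate_mul, hdet, one_smul, map_one, Matrix.one_mulVec]
    _ = ((Int.castRingHom ℚ).mapMatrix M.adjugate).mulVec (Int.castRingHom ℚ ∘ b ∘ f) := by
      rw [map_mul, ← Matrix.mulVec_mulVec, hb]
    _ = _ := funext fun s => ((Int.castRingHom ℚ).map_mulVec _ _ s).symm
  refine ⟨M.adjugate.mulVec (b ∘ f), fun u => ?_⟩
  have hu := hc u
  rw [hq] at hu
  simp only [Function.comp_apply, eq_intCast] at hu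
  exact_mod_cast hu

variable {ι : Type*} [Fintype ι] {p : ι → ZMod 2}

theorem columnSum_orbitCoeff {d : ℕ} [DecidableEq ι] {row col : Fin d → ℕ} {u w : Fin d → ι}
    (hu : Admissible (superSign p) (youngSubgroup row) u)
    (hw : Admissible (twistedSign p) (youngSubgroup col) w) :
    columnSum p row col w
      ⟨_, orbitCoeff_mem_equivariantFunctions (isSignCocycle_superSign p) hu⟩ =
      (Finset.univ.filter fun τ : youngSubgroup col => w ∘ τ.1 = w).card *
        (orbitPairing p row col u w : ℚ) := by
  rw [columnSum_apply, sum_units_mul_comp_eq_card_mul (isSignCocycle_twistedSign p) hw,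
    orbitPairing]
  push_cast
  simp only [mul_comm]

variable {lam : YoungDiagram} {rk : ι → ℕ}

theorem exists_orbitPairing_eq [Fintype {S // Semistandard p rk (rowBlock lam) (cellCol lam) S}]
    (hrk : Function.Injective rk) {w : Fin lam.card → ι}
    (hw : Admissible (twistedSign p) (youngSubgroup (cellCol lam)) w) :
    ∃ q : {S // Semistandard p rk (rowBlock lam) (cellCol lam) S} → ℤ,
      ∀ u, Admissible (superSign p) (youngSubgroup (rowBlock lam)) u →
        orbitPairing p (rowBlock lam) (cellCol lam) u w =
          ∑ S, q S * orbitPairing p (rowBlock lam) (cellCol lam) u S.1 := by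
  classical
  obtain ⟨c, hc⟩ := (Submodule.mem_span_range_iff_exists_fun ℚ).1
    (columnSum_mem_span (p := p) hrk w)
  let N (v : Fin lam.card → ι) : ℚ :=
    (Finset.univ.filter fun τ : youngSubgroup (cellCol lam) => v ∘ τ.1 = v).card
  have hN : N w ≠ 0 := Nat.cast_ne_zero.2 (Finset.card_ne_zero.2 ⟨1, by simp⟩)
  have hrat : ∀ u : {u // Admissible (superSign p) (youngSubgroup (rowBlock lam)) u},
      (orbitPairing p (rowBlock lam) (cellCol lam) u.1 w : ℚ) =
        ∑ S, c S * N S.1 / N w * orbitPairing p (rowBlock lam) (cellCol lam) u.1 S.1 := fun u => by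
    have heval := LinearMap.congr_fun hc
      ⟨_, orbitCoeff_mem_equivariantFunctions (isSignCocycle_superSign p) u.2⟩
    simp only [LinearMap.sum_apply, LinearMap.smul_apply, smul_eq_mul,
      columnSum_orbitCoeff u.2 hw] at heval
    rw [← mul_right_inj' hN, ← heval, Finset.mul_sum]
    refine Finset.sum_congr rfl fun S _ => ?_
    rw [columnSum_orbitCoeff u.2 (S.2.admissible_col position_ext)]
    change c S * (N S.1 * _) = _
    field_simp
  obtain ⟨q, hq⟩ := exists_int_combination
    (A := Matrix.of fun (u : {u // Admissible (superSign p) (youngSubgroup (rowBlock lam)) u})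
      (S : {S // Semistandard p rk (rowBlock lam) (cellCol lam) S}) =>
        orbitPairing p (rowBlock lam) (cellCol lam) u.1 S.1)
    (f := fun S => ⟨S.1, S.2.admissible_row position_ext⟩) (det_orbitPairing hrk position_ext)
    (b := fun u => orbitPairing p (rowBlock lam) (cellCol lam) u.1 w) hrat
  exact ⟨q, fun u hu => hq ⟨u, hu⟩⟩

end Integrality

/-! ### Sign-invariant tensors -/

section SignInvariants

theorem intCast_units_mul_eq_iff {R : Type*} [Ring R] (ε : ℤˣ) {x y : R} :
    ((ε : ℤ) : R) * x = y ↔ x = ((ε : ℤ) : R) * y := by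
  constructor <;> rintro rfl <;> rw [← mul_assoc, intCast_units_mul_self, one_mul]

variable {k : Type*} [Field k] {ι : Type*} [Fintype ι] {d : ℕ} {p : ι → ZMod 2}

theorem repr_permAct_comp (σ : Equiv.Perm (Fin d)) (z : TensorPow k ι d) (w : Fin d → ι) :
    (wordBasis k ι d).repr (permAct k p σ z) (w ∘ σ) =
      ((superSign p w σ : ℤ) : k) * (wordBasis k ι d).repr z w := by
  classical
  suffices h : (wordBasis k ι d).coord (w ∘ σ) ∘ₗ permAct k p σ =
      ((superSign p w σ : ℤ) : k) • (wordBasis k ι d).coord w from LinearMap.congr_fun h z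
  refine (wordBasis k ι d).ext fun v => ?_
  rw [LinearMap.comp_apply, permAct_wordBasis, LinearMap.smul_apply, Units.smul_def, map_zsmul,
    Module.Basis.coord_apply, Module.Basis.coord_apply, Module.Basis.repr_self,
    Module.Basis.repr_self]
  rcases eq_or_ne v w with rfl | hv
  · simp
  · simp [hv, σ.surjective.injective_comp_right.ne hv]

theorem permAct_one (z : TensorPow k ι d) : permAct k p 1 z = z := by
  suffices h : permAct k p (1 : Equiv.Perm (Fin d)) = LinearMap.id (M := TensorPow k ι d) from
    LinearMap.congr_fun h z
  refine (wordBasis k ι d).ext fun w => ?_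
  rw [permAct_wordBasis, superSign_eq_one_of_fixes_odd fun _ _ => rfl]
  simp

variable (k p) in
/-- The tensors on which the permutations of a group act through their signs. -/
def signInvariants (H : Subgroup (Equiv.Perm (Fin d))) : Submodule k (TensorPow k ι d) :=
  ⨅ τ ∈ H, LinearMap.eqLocus (permAct k p τ) ((Equiv.Perm.sign τ : ℤ) • LinearMap.id)

theorem mem_signInvariants {H : Subgroup (Equiv.Perm (Fin d))} {z : TensorPow k ι d} :
    z ∈ signInvariants k p H ↔ ∀ τ ∈ H, permAct k p τ z = Equiv.Perm.sign τ • z := by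
  simp [signInvariants, Submodule.mem_iInf, LinearMap.mem_eqLocus, Units.smul_def]

theorem permAct_eq_sign_smul_iff {τ : Equiv.Perm (Fin d)} {z : TensorPow k ι d} :
    permAct k p τ z = Equiv.Perm.sign τ • z ↔
      ∀ w, (wordBasis k ι d).repr z (w ∘ τ) =
        ((twistedSign p w τ : ℤ) : k) * (wordBasis k ι d).repr z w := by
  have hsurj : Function.Surjective fun w : Fin d → ι => w ∘ τ :=
    fun v => ⟨v ∘ ⇑τ⁻¹, comp_comp_inv v τ⁻¹⟩
  rw [← (wordBasis k ι d).repr.injective.eq_iff, DFunLike.ext_iff]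
  refine hsurj.forall.trans (forall_congr' fun w => ?_)
  rw [repr_permAct_comp, Units.smul_def, ← Int.cast_smul_eq_zsmul k, map_smul, Finsupp.smul_apply,
    smul_eq_mul, eq_comm, intCast_units_mul_eq_iff, twistedSign, Units.val_mul, Int.cast_mul,
    mul_assoc]

theorem mem_signInvariants_iff_repr {H : Subgroup (Equiv.Perm (Fin d))} {z : TensorPow k ι d} :
    z ∈ signInvariants k p H ↔
      ⇑((wordBasis k ι d).repr z) ∈ equivariantFunctions k (twistedSign p) H := by
  simp only [mem_signInvariants, permAct_eq_sign_smul_iff]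
  exact ⟨fun h w τ hτ => h τ hτ w, fun h τ hτ w => h w τ hτ⟩

theorem mem_dividedPow_iff {b : Fin d → ℕ} {x : TensorPow k ι d} :
    x ∈ dividedPow k (fun a => p a + 1) b ↔
      parityShift k p x ∈ signInvariants k p (youngSubgroup b) := by
  simp only [mem_signInvariants, dividedPow, Submodule.mem_iInf, LinearMap.mem_eqLocus,
    LinearMap.id_apply]
  refine forall₂_congr fun σ _ => ?_
  rw [← (Function.LeftInverse.injective (parityShift_parityShift (k := k) p)).eq_iff,
    parityShift_permAct, prod_inversions_neg_one, smul_eq_iff_eq_inv_smul, Int.units_inv_eq_self]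

theorem permAct_mem_signInvariants {b : Fin d → ℕ} {z : TensorPow k ι d}
    (hz : z ∈ signInvariants k p (youngSubgroup b)) (σ : Equiv.Perm (Fin d)) :
    permAct k p σ z ∈ signInvariants k p (youngSubgroup (b ∘ σ)) := by
  rw [mem_signInvariants] at hz ⊢
  intro τ hτ
  have hconj : σ * τ * σ⁻¹ ∈ youngSubgroup b := fun r => by
    simpa using hτ (σ⁻¹ r)
  have hact := hz _ hconj
  rw [Equiv.Perm.sign_mul, Equiv.Perm.sign_mul, Equiv.Perm.sign_inv, mul_right_comm,
    Int.units_mul_self, one_mul] at hact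
  rw [← permAct_mul, ← inv_mul_cancel_right (σ * τ) σ, permAct_mul, hact, Units.smul_def, map_zsmul,
    ← Units.smul_def]

end SignInvariants

/-! ### Super symmetric powers and orbit sums -/

section SuperSymmetricPowers

variable {k : Type*} [Field k] {m n d : ℕ}

theorem restrictScalars_symRelations_le_ker_iff {b : Fin d → ℕ}
    {f : TensorPow k (Fin m ⊕ Fin n) d →ₗ[k] k} :
    (symRelations k m n b).restrictScalars k ≤ LinearMap.ker f ↔
      (fun w => f (wordBasis k _ d w)) ∈
        equivariantFunctions k (superSign (parity m n)) (youngSubgroup b) := by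
  have hgen : (symRelations k m n b).restrictScalars k ≤ LinearMap.ker f ↔
      ∀ σ ∈ youngSubgroup b, f ∘ₗ permAct k (parity m n) σ = f := by
    simp only [symRelations, Submodule.restrictScalars_iSup, iSup_le_iff]
    refine forall₂_congr fun σ _ => ⟨fun h => LinearMap.ext fun x => ?_, ?_⟩
    · exact sub_eq_zero.1 ((map_sub f _ _).symm.trans (h ⟨x, rfl⟩))
    · rintro h _ ⟨x, rfl⟩
      exact (map_sub f _ _).trans (sub_eq_zero.2 (LinearMap.congr_fun h x))
  have hword (σ : Equiv.Perm (Fin d)) (w : Fin d → Fin m ⊕ Fin n) :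
      (f ∘ₗ permAct k (parity m n) σ) (wordBasis k _ d w) = f (wordBasis k _ d w) ↔
        f (wordBasis k _ d (w ∘ σ)) =
          ((superSign (parity m n) w σ : ℤ) : k) * f (wordBasis k _ d w) := by
    rw [LinearMap.comp_apply, permAct_wordBasis, Units.smul_def, ← Int.cast_smul_eq_zsmul k,
      map_smul, smul_eq_mul, intCast_units_mul_eq_iff]
  rw [hgen]
  exact ⟨fun h w σ hσ => (hword σ w).1 (by rw [h σ hσ]),
    fun h σ hσ => (wordBasis k _ d).ext fun w => (hword σ w).2 (h w σ hσ)⟩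

theorem symMk_eq_zero_iff {b : Fin d → ℕ} {z : TensorPow k (Fin m ⊕ Fin n) d} :
    symMk k m n b z = 0 ↔
      ∀ g ∈ equivariantFunctions k (superSign (parity m n)) (youngSubgroup b),
        (wordBasis k _ d).constr k g z = 0 := by
  have hconstr (f : TensorPow k (Fin m ⊕ Fin n) d →ₗ[k] k) :
      (wordBasis k _ d).constr k (fun w => f (wordBasis k _ d w)) = f :=
    (wordBasis k _ d).ext fun w => Module.Basis.constr_basis ..
  refine (Submodule.Quotient.mk_eq_zero _).trans ⟨fun hz g hg => ?_, fun h => ?_⟩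
  · refine restrictScalars_symRelations_le_ker_iff.2 ?_ hz
    simpa only [Module.Basis.constr_basis] using hg
  · by_contra hz
    obtain ⟨f, hf, hker⟩ := Submodule.exists_le_ker_of_notMem
      (p := (symRelations k m n b).restrictScalars k) hz
    exact hf (hconstr f ▸ h _ (restrictScalars_symRelations_le_ker_iff.1 hker))

theorem symMk_eq_zero_iff_orbitCoeff (h2 : (2 : k) ≠ 0) {b : Fin d → ℕ}
    {z : TensorPow k (Fin m ⊕ Fin n) d} :
    symMk k m n b z = 0 ↔ ∀ u, Admissible (superSign (parity m n)) (youngSubgroup b) u →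
      (wordBasis k _ d).constr k
        (fun v => (orbitCoeff (superSign (parity m n)) (youngSubgroup b) u v : k)) z = 0 := by
  rw [symMk_eq_zero_iff, equivariantFunctions_eq_span h2 (isSignCocycle_superSign _)]
  let evaluation : ((Fin d → Fin m ⊕ Fin n) → k) →ₗ[k] k :=
    LinearMap.applyₗ z ∘ₗ ((wordBasis k _ d).constr k).toLinearMap
  refine (Submodule.span_le (p := LinearMap.ker evaluation)).trans
    ⟨fun h u hu => h ⟨u, hu, rfl⟩, ?_⟩
  rintro h _ ⟨u, hu, rfl⟩
  exact h u hu

end SuperSymmetricPowers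

section OrbitTensors

variable {ι : Type*} [Fintype ι] {d : ℕ}

/-- The signed sum over the `H`-orbit of a word, as a tensor. -/
def orbitTensor (k : Type*) [Field k] (χ : (Fin d → ι) → Equiv.Perm (Fin d) → ℤˣ)
    (H : Subgroup (Equiv.Perm (Fin d))) (u : Fin d → ι) : TensorPow k ι d :=
  (wordBasis k ι d).equivFun.symm fun v => (orbitCoeff χ H u v : k)

variable {k : Type*} [Field k] {p : ι → ZMod 2}

theorem signInvariants_eq_span (h2 : (2 : k) ≠ 0) (H : Subgroup (Equiv.Perm (Fin d))) :
    signInvariants k p H = Submodule.span k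
      (orbitTensor k (twistedSign p) H '' {u | Admissible (twistedSign p) H u}) := by
  have hmap : signInvariants k p H = (equivariantFunctions k (twistedSign p) H).map
      ((wordBasis k ι d).equivFun.symm : ((Fin d → ι) → k) →ₗ[k] TensorPow k ι d) := by
    ext z
    rw [Submodule.mem_map_equiv, mem_signInvariants_iff_repr]
    rfl
  rw [hmap, equivariantFunctions_eq_span h2 (isSignCocycle_twistedSign p), Submodule.map_span,
    ← Set.image_comp]
  rfl

theorem constr_orbitCoeff_orbitTensor (row col : Fin d → ℕ) (u w : Fin d → ι) :
    (wordBasis k ι d).constr k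
        (fun v => (orbitCoeff (superSign p) (youngSubgroup row) u v : k))
        (orbitTensor k (twistedSign p) (youngSubgroup col) w) =
      (orbitPairing p row col u w : k) := by
  rw [Module.Basis.constr_apply_fintype, orbitTensor, LinearEquiv.apply_symm_apply,
    orbitPairing, Int.cast_sum]
  exact Finset.sum_congr rfl fun v _ => by rw [Int.cast_mul, mul_comm, smul_eq_mul]

end OrbitTensors

/-! ### A basis of the Schur supermodule -/

section SchurSupermodule

variable {k : Type*} [Field k] {m n : ℕ} {lam : YoungDiagram}

theorem colBlock_comp_sigma : colBlock lam ∘ sigma lam = cellCol lam :=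
  funext fun r => by simp [colBlock, sigma, cellCol]

theorem cellCol_comp_sigma_inv : cellCol lam ∘ ⇑(sigma lam)⁻¹ = colBlock lam := by
  rw [← colBlock_comp_sigma, comp_comp_inv]

theorem restrictScalars_schurSupermodule_eq_map :
    (SchurSupermodule k m n lam).restrictScalars k =
      (signInvariants k (parity m n) (youngSubgroup (cellCol lam))).map
        ((symMk k m n (rowBlock lam)).restrictScalars k) := by
  ext y
  constructor
  · rintro ⟨⟨x, hx⟩, rfl⟩
    have hz := permAct_mem_signInvariants (mem_dividedPow_iff.1 hx) (sigma lam)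
    rw [colBlock_comp_sigma] at hz
    exact ⟨_, hz, rfl⟩
  · rintro ⟨z, hz, rfl⟩
    have hx := permAct_mem_signInvariants hz (sigma lam)⁻¹
    rw [cellCol_comp_sigma_inv, ← parityShift_parityShift (parity m n) (permAct k _ _ z),
      ← mem_dividedPow_iff] at hx
    refine ⟨⟨_, hx⟩, ?_⟩
    rw [theta_apply, parityShift_parityShift]
    refine congr_arg (symMk k m n (rowBlock lam)) ?_
    exact (permAct_mul ..).symm.trans (by rw [inv_mul_cancel, permAct_one])

/-- The position of a letter in the order `X₁, …, X_m, Y₁, …, Y_n`. -/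
def letterRank (m n : ℕ) (a : Fin m ⊕ Fin n) : ℕ := finSumFinEquiv a

theorem letterRank_injective (m n : ℕ) : Function.Injective (letterRank m n) :=
  Fin.val_injective.comp finSumFinEquiv.injective

/-- The semistandard fillings of the diagram `lam` by the letters `X₁, …, X_m, Y₁, …, Y_n`, as words
in the row reading. -/
abbrev SemistandardWord (m n : ℕ) (lam : YoungDiagram) : Type :=
  {S : Fin lam.card → Fin m ⊕ Fin n //
    Semistandard (parity m n) (letterRank m n) (rowBlock lam) (cellCol lam) S}

instance (m n : ℕ) (lam : YoungDiagram) : Fintype (SemistandardWord m n lam) :=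
  Fintype.ofFinite _

/-- The image in `S^λ M` of the twisted signed sum over the column orbit of a word. -/
def schurVector (k : Type*) [Field k] {m n : ℕ} {lam : YoungDiagram}
    (u : Fin lam.card → Fin m ⊕ Fin n) : SymPow k m n (rowBlock lam) :=
  symMk k m n (rowBlock lam)
    (orbitTensor k (twistedSign (parity m n)) (youngSubgroup (cellCol lam)) u)

section LinearRelations

variable {J : Type*} [Fintype J] {w : J → Fin lam.card → Fin m ⊕ Fin n} {a : J → k}

theorem sum_smul_schurVector :
    ∑ j, a j • schurVector k (w j) = symMk k m n (rowBlock lam)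
      (∑ j, a j •
        orbitTensor k (twistedSign (parity m n)) (youngSubgroup (cellCol lam)) (w j)) := by
  refine Eq.trans ?_ (map_sum ((symMk k m n (rowBlock lam)).restrictScalars k) _ _).symm
  simp only [map_smul]
  rfl

theorem constr_orbitCoeff_sum_smul_orbitTensor (u : Fin lam.card → Fin m ⊕ Fin n) :
    (wordBasis k _ lam.card).constr k
        (fun v => (orbitCoeff (superSign (parity m n)) (youngSubgroup (rowBlock lam)) u v : k))
        (∑ j, a j •
          orbitTensor k (twistedSign (parity m n)) (youngSubgroup (cellCol lam)) (w j)) =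
      ∑ j, a j * (orbitPairing (parity m n) (rowBlock lam) (cellCol lam) u (w j) : k) := by
  simp only [map_sum, map_smul, constr_orbitCoeff_orbitTensor, smul_eq_mul]

theorem sum_mul_orbitPairing_eq_zero (ha : ∑ j, a j • schurVector k (w j) = 0)
    {u : Fin lam.card → Fin m ⊕ Fin n}
    (hu : Admissible (superSign (parity m n)) (youngSubgroup (rowBlock lam)) u) :
    ∑ j, a j * (orbitPairing (parity m n) (rowBlock lam) (cellCol lam) u (w j) : k) = 0 := by
  rw [sum_smul_schurVector, symMk_eq_zero_iff] at ha
  rw [← constr_orbitCoeff_sum_smul_orbitTensor]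
  exact ha _ (orbitCoeff_mem_equivariantFunctions (isSignCocycle_superSign _) hu)

theorem sum_smul_schurVector_eq_zero (h2 : (2 : k) ≠ 0)
    (ha : ∀ u, Admissible (superSign (parity m n)) (youngSubgroup (rowBlock lam)) u →
      ∑ j, a j * (orbitPairing (parity m n) (rowBlock lam) (cellCol lam) u (w j) : k) = 0) :
    ∑ j, a j • schurVector k (w j) = 0 := by
  rw [sum_smul_schurVector, symMk_eq_zero_iff_orbitCoeff h2]
  exact fun u hu => (constr_orbitCoeff_sum_smul_orbitTensor u).trans (ha u hu)

end LinearRelations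

theorem linearIndependent_schurVector :
    LinearIndependent k fun S : SemistandardWord m n lam => schurVector k S.1 := by
  classical
  rw [Fintype.linearIndependent_iff]
  intro a ha
  let pairing : Matrix (SemistandardWord m n lam) (SemistandardWord m n lam) ℤ :=
    Matrix.of fun u w => orbitPairing (parity m n) (rowBlock lam) (cellCol lam) u.1 w.1
  have hdet : (pairing.map (Int.castRingHom k)).det = 1 := by
    rw [← RingHom.mapMatrix_apply, ← RingHom.map_det,
      det_orbitPairing (letterRank_injective m n) position_ext, map_one]
  refine congr_fun (Matrix.eq_zero_of_mulVec_eq_zero (hdet ▸ one_ne_zero) (funext fun u => ?_))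
  refine Eq.trans ?_ (sum_mul_orbitPairing_eq_zero ha (u.2.admissible_row position_ext))
  exact Finset.sum_congr rfl fun w _ => mul_comm _ _

theorem schurVector_mem_span (h2 : (2 : k) ≠ 0) {w : Fin lam.card → Fin m ⊕ Fin n}
    (hw : Admissible (twistedSign (parity m n)) (youngSubgroup (cellCol lam)) w) :
    schurVector k w ∈
      Submodule.span k (Set.range fun S : SemistandardWord m n lam => schurVector k S.1) := by
  obtain ⟨q, hq⟩ := exists_orbitPairing_eq (letterRank_injective m n) hw
  have hrel : ∑ j : Option (SemistandardWord m n lam), j.elim (-1) (fun S => (q S : k)) •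
      schurVector k (j.elim w Subtype.val) = 0 := by
    refine sum_smul_schurVector_eq_zero h2 fun u hu => ?_
    simp [Fintype.sum_option, hq u hu]
  have hsum : schurVector k w = ∑ S : SemistandardWord m n lam, (q S : k) • schurVector k S.1 := by
    simpa [Fintype.sum_option, neg_add_eq_zero] using hrel
  rw [hsum]
  exact Submodule.sum_mem _ fun S _ => Submodule.smul_mem _ _ (Submodule.subset_span ⟨S, rfl⟩)

theorem restrictScalars_schurSupermodule (h2 : (2 : k) ≠ 0) :
    (SchurSupermodule k m n lam).restrictScalars k =
      Submodule.span k (Set.range fun S : SemistandardWord m n lam => schurVector k S.1) := by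
  rw [restrictScalars_schurSupermodule_eq_map, signInvariants_eq_span h2, Submodule.map_span,
    ← Set.image_comp]
  refine le_antisymm (Submodule.span_le.2 ?_) (Submodule.span_mono ?_)
  · rintro _ ⟨u, hu, rfl⟩
    exact schurVector_mem_span h2 hu
  · rintro _ ⟨S, rfl⟩
    exact ⟨S.1, S.2.admissible_col position_ext, rfl⟩

end SchurSupermodule

/-! ### The character of the Schur supermodule -/

section FormalCharacter

variable {k : Type*} [Field k] {m n d : ℕ}

theorem finrank_range_of_diagonal {V I : Type*} [AddCommGroup V] [Module k V] [Fintype I]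
    (B : Module.Basis I k V) (P : I → Prop) [DecidablePred P] {f : V →ₗ[k] V}
    (hf : ∀ i, f (B i) = if P i then B i else 0) :
    Module.finrank k (LinearMap.range f) = Fintype.card {i // P i} := by
  have hrange : LinearMap.range f = Submodule.span k (Set.range fun i : {i // P i} => B i) := by
    rw [LinearMap.range_eq_map, ← B.span_eq, Submodule.map_span, ← Set.range_comp]
    refine le_antisymm (Submodule.span_le.2 ?_) (Submodule.span_mono ?_)
    · rintro _ ⟨i, rfl⟩
      rw [Function.comp_apply, hf]
      split_ifs with hi
      · exact Submodule.subset_span ⟨⟨i, hi⟩, rfl⟩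
      · exact Submodule.zero_mem _
    · rintro _ ⟨⟨i, hi⟩, rfl⟩
      exact ⟨i, by rw [Function.comp_apply, hf, if_pos hi]⟩
  rw [hrange]
  exact finrank_span_eq_card (B.linearIndependent.comp _ Subtype.val_injective)

theorem formalCharacter_eq_sum_monomial {V I : Type*} [AddCommGroup V] [Module k V]
    [Module (SchurSuperalgebra k m n d) V] [IsScalarTower k (SchurSuperalgebra k m n d) V]
    [Module.Finite k V] [Fintype I] (B : Module.Basis I k V) {wt : I → Fin m ⊕ Fin n →₀ ℕ}
    (hdeg : ∀ i, ∑ a, wt i a = d)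
    (hB : ∀ μ i, weightIdempotent k m n d μ • B i = if wt i = μ then B i else 0) :
    formalCharacter k m n d V = ∑ i, MvPolynomial.monomial (wt i) 1 := by
  have hmaps : ∀ i ∈ Finset.univ, wt i ∈ Finset.finsuppAntidiag Finset.univ d := fun i _ =>
    Finset.mem_finsuppAntidiag.2 ⟨hdeg i, Finset.subset_univ _⟩
  rw [formalCharacter, ← Finset.sum_fiberwise_of_maps_to hmaps]
  refine Finset.sum_congr rfl fun μ _ => ?_
  rw [weightSpace, finrank_range_of_diagonal B (fun i => wt i = μ) (hB μ), Fintype.card_subtype,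
    Finset.sum_congr rfl fun i hi => by rw [(Finset.mem_filter.1 hi).2], Finset.sum_const,
    ← map_nsmul, nsmul_one]

section WordWeight

variable {ι : Type*} [Fintype ι] [DecidableEq ι]

theorem wordWeight_comp (w : Fin d → ι) (σ : Equiv.Perm (Fin d)) :
    wordWeight (w ∘ σ) = wordWeight w :=
  Equiv.sum_comp σ fun r => Finsupp.single (w r) 1

theorem sum_wordWeight (w : Fin d → ι) : ∑ a, wordWeight w a = d := by
  simp only [wordWeight, Finsupp.finsetSum_apply]
  rw [Finset.sum_comm]
  simp [Finsupp.single_apply]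

theorem prod_X_eq_monomial {R : Type*} [CommSemiring R] (w : Fin d → ι) :
    ∏ r, (MvPolynomial.X (w r) : MvPolynomial ι R) =
      MvPolynomial.monomial (wordWeight w) 1 := by
  rw [wordWeight, MvPolynomial.monomial_sum_one]
  rfl

end WordWeight

theorem weightIdempotent_smul_orbitTensor {H : Subgroup (Equiv.Perm (Fin d))}
    {χ : (Fin d → Fin m ⊕ Fin n) → Equiv.Perm (Fin d) → ℤˣ} (μ : Fin m ⊕ Fin n →₀ ℕ)
    (u : Fin d → Fin m ⊕ Fin n) :
    weightIdempotent k m n d μ • orbitTensor k χ H u =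
      if wordWeight u = μ then orbitTensor k χ H u else 0 := by
  have hterm (v : Fin d → Fin m ⊕ Fin n) :
      (orbitCoeff χ H u v : k) • (if wordWeight v = μ then wordBasis k _ d v else 0) =
        if wordWeight u = μ then (orbitCoeff χ H u v : k) • wordBasis k _ d v else 0 := by
    by_cases hv : orbitCoeff χ H u v = 0
    · simp [hv]
    · obtain ⟨σ, -, rfl⟩ := exists_of_orbitCoeff_ne_zero hv
      rw [wordWeight_comp, smul_ite, smul_zero]
  change (∑ w : Fin d → Fin m ⊕ Fin n with wordWeight w = μ, diagonalUnit k w) _ = _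
  rw [orbitTensor, Module.Basis.equivFun_symm_apply, map_sum]
  simp only [map_smul, sum_diagonalUnit_wordBasis, hterm]
  split_ifs <;> simp

variable {lam : YoungDiagram}

theorem weightIdempotent_smul_schurVector (μ : Fin m ⊕ Fin n →₀ ℕ)
    (u : Fin lam.card → Fin m ⊕ Fin n) :
    weightIdempotent k m n lam.card μ • schurVector k u =
      if wordWeight u = μ then schurVector k u else 0 := by
  rw [schurVector, ← map_smul, weightIdempotent_smul_orbitTensor]
  split_ifs
  · rfl
  · exact map_zero _

/-- The basis of the Schur supermodule indexed by the semistandard words. -/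
def schurBasis (h2 : (2 : k) ≠ 0) (m n : ℕ) (lam : YoungDiagram) :
    Module.Basis (SemistandardWord m n lam) k (SchurSupermodule k m n lam) :=
  (Module.Basis.span linearIndependent_schurVector).map <|
    (LinearEquiv.ofEq _ _ (restrictScalars_schurSupermodule h2).symm).trans
      (((SchurSupermodule k m n lam).restrictScalarsEquiv k _ _).restrictScalars k)

theorem coe_schurBasis (h2 : (2 : k) ≠ 0) (S : SemistandardWord m n lam) :
    (schurBasis h2 m n lam S : SymPow k m n (rowBlock lam)) = schurVector k S.1 :=
  congr_arg Subtype.val (Module.Basis.span_apply linearIndependent_schurVector S)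

theorem formalCharacter_schurSupermodule (h2 : (2 : k) ≠ 0) (m n : ℕ) (lam : YoungDiagram) :
    formalCharacter k m n lam.card (SchurSupermodule k m n lam) =
      ∑ S : SemistandardWord m n lam, ∏ r, MvPolynomial.X (S.1 r) := by
  simp only [prod_X_eq_monomial]
  refine formalCharacter_eq_sum_monomial (schurBasis h2 m n lam) (fun S => sum_wordWeight S.1)
    fun μ S => Subtype.ext ?_
  rw [Submodule.coe_smul, coe_schurBasis, weightIdempotent_smul_schurVector]
  split_ifs
  · exact (coe_schurBasis h2 S).symm
  · rfl

end FormalCharacter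

/-! ### Semistandard words and pairs of tableaux -/

section LetterOrder

variable {m n : ℕ}

theorem letterRank_inl_lt_inr (a : Fin m) (b : Fin n) :
    letterRank m n (Sum.inl a) < letterRank m n (Sum.inr b) := by
  simp only [letterRank, finSumFinEquiv_apply_left, finSumFinEquiv_apply_right, Fin.val_castAdd,
    Fin.val_natAdd]
  omega

theorem letterRank_inl_lt_inl {a b : Fin m} :
    letterRank m n (Sum.inl a) < letterRank m n (Sum.inl b) ↔ a < b := by
  simp [letterRank]

theorem letterRank_inr_lt_inr {a b : Fin n} :
    letterRank m n (Sum.inr a) < letterRank m n (Sum.inr b) ↔ a < b := by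
  simp [letterRank]

theorem parity_inl (a : Fin m) : parity m n (Sum.inl a) = 0 := rfl

theorem parity_inr (b : Fin n) : parity m n (Sum.inr b) = 1 := rfl

end LetterOrder

section HookFilling

variable {m n : ℕ} {lam mu : YoungDiagram}

/-- The positions of the cells of `mu`, in bijection with the cells of a tableau of shape `mu`. -/
def evenCellEquiv (hmu : mu ≤ lam) :
    {r : Fin lam.card // (rowReading lam r).1 ∈ mu.cells} ≃
      (mu.cells \ (⊥ : YoungDiagram).cells : Finset (ℕ × ℕ)) where
  toFun r := ⟨(rowReading lam r).1, by simpa using r.2⟩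
  invFun c := ⟨(rowReading lam).symm ⟨c, hmu (Finset.mem_sdiff.1 c.2).1⟩, by
    simpa using (Finset.mem_sdiff.1 c.2).1⟩
  left_inv r := by simp
  right_inv c := by simp

theorem mem_transpose_sdiff {c : ℕ × ℕ} :
    c ∈ lam.transpose.cells \ mu.transpose.cells ↔ c.swap ∈ lam.cells ∧ c.swap ∉ mu.cells := by
  simp [Finset.mem_sdiff, YoungDiagram.mem_transpose]

variable (lam mu) in
/-- The positions of the cells outside `mu`, in bijection with the cells of a tableau of shape
`λ' / μ'`. -/
def oddCellEquiv :
    {r : Fin lam.card // (rowReading lam r).1 ∉ mu.cells} ≃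
      (lam.transpose.cells \ mu.transpose.cells : Finset (ℕ × ℕ)) where
  toFun r := ⟨(rowReading lam r).1.swap, mem_transpose_sdiff.2 ⟨(rowReading lam r).2, r.2⟩⟩
  invFun c := ⟨(rowReading lam).symm ⟨c.1.swap, (mem_transpose_sdiff.1 c.2).1⟩, by
    simpa using (mem_transpose_sdiff.1 c.2).2⟩
  left_inv r := by simp
  right_inv c := by simp

/-- The word of shape `lam` with the even letters `T₁` on `mu` and the odd letters `T₂`, transposed,
outside `mu`. -/
def hookFilling (hmu : mu ≤ lam)
    (T₁ : (mu.cells \ (⊥ : YoungDiagram).cells : Finset (ℕ × ℕ)) → Fin m)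
    (T₂ : (lam.transpose.cells \ mu.transpose.cells : Finset (ℕ × ℕ)) → Fin n)
    (r : Fin lam.card) : Fin m ⊕ Fin n :=
  if h : (rowReading lam r).1 ∈ mu.cells then Sum.inl (T₁ (evenCellEquiv hmu ⟨r, h⟩))
  else Sum.inr (T₂ (oddCellEquiv lam mu ⟨r, h⟩))

variable {hmu : mu ≤ lam} {T₁ : (mu.cells \ (⊥ : YoungDiagram).cells : Finset (ℕ × ℕ)) → Fin m}
  {T₂ : (lam.transpose.cells \ mu.transpose.cells : Finset (ℕ × ℕ)) → Fin n}

theorem hookFilling_of_mem (r : {r : Fin lam.card // (rowReading lam r).1 ∈ mu.cells}) :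
    hookFilling hmu T₁ T₂ r = Sum.inl (T₁ (evenCellEquiv hmu r)) :=
  dif_pos r.2

theorem hookFilling_of_notMem (r : {r : Fin lam.card // (rowReading lam r).1 ∉ mu.cells}) :
    hookFilling hmu T₁ T₂ r = Sum.inr (T₂ (oddCellEquiv lam mu r)) :=
  dif_neg r.2

theorem isLeft_hookFilling_iff (r : Fin lam.card) :
    (hookFilling hmu T₁ T₂ r).isLeft ↔ (rowReading lam r).1 ∈ mu.cells := by
  by_cases hr : (rowReading lam r).1 ∈ mu.cells
  · simp [hookFilling_of_mem ⟨r, hr⟩, hr]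
  · simp [hookFilling_of_notMem ⟨r, hr⟩, hr]

theorem hookFilling_injective :
    Function.Injective fun T : _ × _ => hookFilling (m := m) (n := n) hmu T.1 T.2 := by
  rintro ⟨T₁, T₂⟩ ⟨T₁', T₂'⟩ heq
  refine Prod.ext (funext ((evenCellEquiv hmu).surjective.forall.2 fun r => ?_))
    (funext ((oddCellEquiv lam mu).surjective.forall.2 fun r => ?_))
  · simpa [hookFilling_of_mem] using congr_fun heq r.1
  · simpa [hookFilling_of_notMem] using congr_fun heq r.1

theorem exists_hookFilling_eq (hmu : mu ≤ lam) {w : Fin lam.card → Fin m ⊕ Fin n}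
    (hw : ∀ r, (w r).isLeft ↔ (rowReading lam r).1 ∈ mu.cells) :
    ∃ T₁ T₂, hookFilling hmu T₁ T₂ = w := by
  refine ⟨fun c => (w ((evenCellEquiv hmu).symm c)).getLeft
      ((hw _).2 ((evenCellEquiv hmu).symm c).2),
    fun c => (w ((oddCellEquiv lam mu).symm c)).getRight ?_, funext fun r => ?_⟩
  · rw [← Sum.not_isLeft, hw]
    exact ((oddCellEquiv lam mu).symm c).2
  · by_cases hr : (rowReading lam r).1 ∈ mu.cells
    · simp [hookFilling_of_mem ⟨r, hr⟩]
    · simp [hookFilling_of_notMem ⟨r, hr⟩]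

theorem prod_hookFilling {R : Type*} [CommMonoid R] (f : Fin m ⊕ Fin n → R) :
    ∏ r, f (hookFilling hmu T₁ T₂ r) = (∏ c, f (Sum.inl (T₁ c))) * ∏ c, f (Sum.inr (T₂ c)) := by
  rw [← Fintype.prod_subtype_mul_prod_subtype fun r => (rowReading lam r).1 ∈ mu.cells]
  simp only [hookFilling_of_mem, hookFilling_of_notMem]
  rw [Equiv.prod_comp (evenCellEquiv hmu) fun c => f (Sum.inl (T₁ c)),
    Equiv.prod_comp (oddCellEquiv lam mu) fun c => f (Sum.inr (T₂ c))]

theorem forall_hookFilling_iff {Q : ℕ × ℕ → ℕ × ℕ → Prop}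
    {R : Fin m ⊕ Fin n → Fin m ⊕ Fin n → Prop}
    (hQ : ∀ c c', Q c c' → c' ∈ mu.cells → c ∈ mu.cells) (hR : ∀ a b, R (Sum.inl a) (Sum.inr b)) :
    (∀ r s, Q (rowReading lam r).1 (rowReading lam s).1 →
      R (hookFilling hmu T₁ T₂ r) (hookFilling hmu T₁ T₂ s)) ↔
      (∀ c c', Q c.1 c'.1 → R (Sum.inl (T₁ c)) (Sum.inl (T₁ c'))) ∧
        ∀ c c', Q c.1.swap c'.1.swap → R (Sum.inr (T₂ c)) (Sum.inr (T₂ c')) := by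
  rw [(evenCellEquiv hmu).surjective.forall₂, (oddCellEquiv lam mu).surjective.forall₂]
  simp only [← hookFilling_of_mem (T₂ := T₂), ← hookFilling_of_notMem (hmu := hmu) (T₁ := T₁)]
  refine ⟨fun h => ⟨fun r s => h r s, fun r s => h r s⟩, fun ⟨heven, hodd⟩ r s hrs => ?_⟩
  by_cases hs : (rowReading lam s).1 ∈ mu.cells
  · exact heven ⟨r, hQ _ _ hrs hs⟩ ⟨s, hs⟩ hrs
  by_cases hr : (rowReading lam r).1 ∈ mu.cells
  · rw [hookFilling_of_mem ⟨r, hr⟩, hookFilling_of_notMem ⟨s, hs⟩]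
    exact hR _ _
  · exact hodd ⟨r, hr⟩ ⟨s, hs⟩ hrs

theorem blockOrdered_rows_hookFilling_iff :
    BlockOrdered (parity m n) (letterRank m n) (rowBlock lam) (cellCol lam)
        (hookFilling hmu T₁ T₂) ↔
      (∀ c c', c.1.1 = c'.1.1 → c.1.2 < c'.1.2 → T₁ c ≤ T₁ c') ∧
        ∀ c c', c.1.2 = c'.1.2 → c.1.1 < c'.1.1 → T₂ c < T₂ c' := by
  have h := forall_hookFilling_iff (hmu := hmu) (T₁ := T₁) (T₂ := T₂)
    (Q := fun c c' => c.1 = c'.1 ∧ c.2 < c'.2)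
    (R := fun a b => letterRank m n a < letterRank m n b ∨ a = b ∧ parity m n a = 0)
    (fun c c' hc => mu.isLowerSet ⟨hc.1.le, hc.2.le⟩)
    (fun a b => Or.inl (letterRank_inl_lt_inr a b))
  simp only [and_imp, letterRank_inl_lt_inl, letterRank_inr_lt_inr, Sum.inl.injEq, Sum.inr.injEq,
    parity_inl, parity_inr, one_ne_zero, and_true, and_false, or_false, ← le_iff_lt_or_eq,
    Prod.fst_swap, Prod.snd_swap] at h
  exact h

theorem blockOrdered_cols_hookFilling_iff :
    BlockOrdered (fun a => parity m n a + 1) (letterRank m n) (cellCol lam) (rowBlock lam)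
        (hookFilling hmu T₁ T₂) ↔
      (∀ c c', c.1.2 = c'.1.2 → c.1.1 < c'.1.1 → T₁ c < T₁ c') ∧
        ∀ c c', c.1.1 = c'.1.1 → c.1.2 < c'.1.2 → T₂ c ≤ T₂ c' := by
  have h := forall_hookFilling_iff (hmu := hmu) (T₁ := T₁) (T₂ := T₂)
    (Q := fun c c' => c.2 = c'.2 ∧ c.1 < c'.1)
    (R := fun a b => letterRank m n a < letterRank m n b ∨ a = b ∧ parity m n a + 1 = 0)
    (fun c c' hc => mu.isLowerSet ⟨hc.2.le, hc.1.le⟩)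
    (fun a b => Or.inl (letterRank_inl_lt_inr a b))
  simp only [and_imp, letterRank_inl_lt_inl, letterRank_inr_lt_inr, Sum.inl.injEq, Sum.inr.injEq,
    parity_inl, parity_inr, zero_add, CharTwo.add_self_eq_zero, one_ne_zero, and_true, and_false,
    or_false, ← le_iff_lt_or_eq, Prod.fst_swap, Prod.snd_swap] at h
  exact h

theorem semistandard_hookFilling_iff :
    Semistandard (parity m n) (letterRank m n) (rowBlock lam) (cellCol lam)
        (hookFilling hmu T₁ T₂) ↔
      T₁ ∈ skewTableaux m mu ⊥ ∧ T₂ ∈ skewTableaux n lam.transpose mu.transpose := by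
  have hparts := and_congr (blockOrdered_rows_hookFilling_iff (hmu := hmu) (T₁ := T₁) (T₂ := T₂))
    (blockOrdered_cols_hookFilling_iff (hmu := hmu) (T₁ := T₁) (T₂ := T₂))
  exact ⟨fun h => let ⟨⟨a, b⟩, c, d⟩ := hparts.1 ⟨h.rows, h.cols⟩; ⟨⟨a, c⟩, d, b⟩,
    fun ⟨⟨a, c⟩, d, b⟩ => let h := hparts.2 ⟨⟨a, b⟩, c, d⟩; ⟨h.1, h.2⟩⟩

end HookFilling

section EvenShape

variable {m n : ℕ} {lam mu : YoungDiagram}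

theorem Semistandard.rank_le {ι : Type*} {p : ι → ZMod 2} {rk : ι → ℕ} {w : Fin lam.card → ι}
    (hw : Semistandard p rk (rowBlock lam) (cellCol lam) w) {r s : Fin lam.card}
    (hrow : rowBlock lam r ≤ rowBlock lam s) (hcol : cellCol lam r ≤ cellCol lam s) :
    rk (w r) ≤ rk (w s) := by
  obtain ⟨t, htrow, htcol⟩ := exists_position (lam.up_left_mem hrow le_rfl (cell_mem s))
  have hrt : rk (w r) ≤ rk (w t) := by
    rcases (hcol.trans_eq htcol.symm).eq_or_lt with heq | hlt
    · rw [position_ext r t htrow.symm heq]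
    · exact hw.rows.isBlockSorted r t htrow.symm hlt
  have hts : rk (w t) ≤ rk (w s) := by
    rcases (htrow.trans_le hrow).eq_or_lt with heq | hlt
    · rw [position_ext t s heq htcol]
    · exact hw.cols.isBlockSorted t s htcol hlt
  exact hrt.trans hts

/-- The shape of the even part of a semistandard word: the cells that hold even letters. -/
def evenShape (S : SemistandardWord m n lam) : YoungDiagram where
  cells := {r | (S.1 r).isLeft}.toFinset.map
    ((rowReading lam).toEmbedding.trans (Function.Embedding.subtype _))
  isLowerSet := by
    intro c c' hle hc
    simp only [Finset.coe_map, Set.coe_toFinset, Set.mem_image, Set.mem_ofPred_eq,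
      Function.Embedding.trans_apply, Equiv.coe_toEmbedding, Function.Embedding.subtype_apply]
      at hc ⊢
    obtain ⟨s, hs, rfl⟩ := hc
    obtain ⟨r, hr⟩ := (rowReading lam).surjective ⟨c', lam.isLowerSet hle (rowReading lam s).2⟩
    obtain rfl : (rowReading lam r).1 = c' := congr_arg Subtype.val hr
    refine ⟨r, ?_, rfl⟩
    obtain ⟨a, ha⟩ := Sum.isLeft_iff.1 hs
    have hrank := S.2.rank_le hle.1 hle.2
    rcases hb : S.1 r with b | b
    · rfl
    · rw [ha, hb] at hrank
      exact absurd hrank (letterRank_inl_lt_inr a b).not_ge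

theorem rowReading_mem_evenShape {S : SemistandardWord m n lam} {r : Fin lam.card} :
    (rowReading lam r).1 ∈ (evenShape S).cells ↔ (S.1 r).isLeft := by
  simp [evenShape]

theorem evenShape_le (S : SemistandardWord m n lam) : evenShape S ≤ lam := by
  intro c hc
  obtain ⟨r, -, rfl⟩ := Finset.mem_map.1 ((YoungDiagram.mem_cells _).2 hc)
  exact (rowReading lam r).2

theorem evenShape_eq_iff (hmu : mu ≤ lam) {S : SemistandardWord m n lam} :
    evenShape S = mu ↔ ∀ r, (S.1 r).isLeft ↔ (rowReading lam r).1 ∈ mu.cells := by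
  refine ⟨fun h r => h ▸ rowReading_mem_evenShape.symm, fun h => YoungDiagram.ext ?_⟩
  ext c
  by_cases hc : c ∈ lam.cells
  · obtain ⟨r, hr⟩ := (rowReading lam).surjective ⟨c, hc⟩
    obtain rfl : (rowReading lam r).1 = c := congr_arg Subtype.val hr
    rw [rowReading_mem_evenShape, h]
  · exact iff_of_false (fun h' => hc (evenShape_le S h')) fun h' => hc (hmu h')

end EvenShape

theorem hookSchur_eq_sum (m n : ℕ) (lam : YoungDiagram) :
    hookSchur m n lam = ∑ S : SemistandardWord m n lam, ∏ r, MvPolynomial.X (S.1 r) := by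
  classical
  rw [hookSchur, ← Finset.sum_fiberwise_of_maps_to
    (t := (finite_subdiagrams lam).toFinset) (g := evenShape) fun S _ => by
      simpa using evenShape_le S]
  refine Finset.sum_congr rfl fun mu hmu => ?_
  replace hmu : mu ≤ lam := by simpa using hmu
  rw [schur, skewSchur, skewSchur, map_sum, map_sum, Finset.sum_mul_sum, ← Finset.sum_product']
  refine Finset.sum_bij (fun T hT => ⟨hookFilling hmu T.1 T.2,
    semistandard_hookFilling_iff.2 (by simpa using hT)⟩) ?_ ?_ ?_ ?_
  · exact fun T _ => Finset.mem_filter.2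
      ⟨Finset.mem_univ _, (evenShape_eq_iff hmu).2 isLeft_hookFilling_iff⟩
  · exact fun T _ T' _ h => hookFilling_injective (congr_arg Subtype.val h)
  · intro S hS
    obtain ⟨T₁, T₂, h⟩ :=
      exists_hookFilling_eq hmu ((evenShape_eq_iff hmu).1 (Finset.mem_filter.1 hS).2)
    have htableaux := semistandard_hookFilling_iff.1 (h.symm ▸ S.2)
    exact ⟨(T₁, T₂), by simpa using htableaux, Subtype.ext h⟩
  · intro T _
    simp only [prod_hookFilling, map_prod, MvPolynomial.rename_X]

end SchurSuper

end

theorem mainTheorem5 (k : Type*) [Field k] (hk : ringChar k ≠ 2) (m n : ℕ) (lam : YoungDiagram) :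
    SchurSuper.formalCharacter k m n lam.card (SchurSuper.SchurSupermodule k m n lam) =
      SchurSuper.hookSchur m n lam := by
  have h2 : (2 : k) ≠ 0 := Ring.two_ne_zero hk
  rw [SchurSuper.formalCharacter_schurSupermodule h2, SchurSuper.hookSchur_eq_sum]
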